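/- Let $M$ be a compact (Hausdorff, smooth, finite-dimensional, boundaryless, not necessarily connected) manifold, let $U$ be any nonempty set, and for each $v\in U$ let $X(\cdot,v)$ be a smooth complete vector field on $M$. Consider the control system $\dot q(t)=X(q(t),u(t))$ and let $\mathcal F=\{X(\cdot,v)\mid v\in U\}$. Let $\mathrm{Lie}(\mathcal F)$ be the Lie algebra of vector fields generated by $\mathcal F$, and assume the Lie algebra rank condition: $\{Y(q)\mid Y\in \mathrm{Lie}(\mathcal F)\}=T_qM$ for every $q\in M$. Fix $\tau\ge 0$. Let $\mathcal U^\tau$ be the set of signals $u:[0,T(u)]\to U$ that are concatenations of finitely many (at least one) constant signals, each of duration at least $\tau$, and let $\mathcal U^\tau_\infty$ be the set of signals $u:[0,\infty)\to U$ for which there are $T_n\to\infty$ with $u|_{[0,T_n]}\in\mathcal U^\tau$ for every $n$. (Signals are taken left-continuous at positive times, and their value at the initial time is disregarded; restrictions $u|_{[t,T]}$, $u|_{[t,\infty)}$ are translated to start at time $0$.) Let $\phi(\cdot,q,u)$ be the trajectory that starts at $q$ and is driven by $u$, let $\mathfrak S^\tau=\{\phi(T(u),\cdot,u)\mid u\in\mathcal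 U^\tau\}$, and let $\mathfrak S^\tau(q)=\{g(q)\mid g\in\mathfrak S^\tau\}$. A set $D\subset M$ is a $\tau$ dwell-time control set if: (i) for every $q\in D$ there is $u\in\mathcal U^\tau_\infty$ such that $\phi(t,q,u)\in D$ for all $t>0$ for which both $u|_{[0,t]}\in\mathcal U^\tau$ and $u|_{[t,\infty)}\in\mathcal U^\tau_\infty$; (ii) $D\subset\overline{\mathfrak S^\tau(q)}$ for every $q\in D$; (iii) $D$ is maximal with these properties: if $D'\supset D$ satisfies (i) and (ii), then $D'=D$. It is an invariant $\tau$ dwell-time control set if, moreover, $\overline D=\overline{\mathfrak S^\tau(q)}$ for every $q\in D$. Then there are only finitely many distinct invariant $\tau$ dwell-time control sets on $M$. -/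

import Mathlib

open scoped Manifold ContDiff

namespace DwellTime

section LieAlgebra

/-- `Lie(F)`: the Lie algebra of vector fields generated by the set `F` of vector fields, i.e. the
smallest real vector space of vector fields that contains `F` and is stable under the Lie
bracket. (If all members of `F` are smooth, then so are all its elements.) -/
noncomputable def lieHull {d : ℕ} {M : Type*} [TopologicalSpace M]
    [ChartedSpace (EuclideanSpace ℝ (Fin d)) M]
    (F : Set (∀ q : M, TangentSpace (𝓡 d) q)) :
    Submodule ℝ (∀ q : M, TangentSpace (𝓡 d) q) :=
  sInf {L | F ⊆ (L : Set (∀ q : M, TangentSpace (𝓡 d) q)) ∧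
    ∀ V ∈ L, ∀ W ∈ L, VectorField.mlieBracket (𝓡 d) V W ∈ L}

/-- The Lie algebra rank condition for the family `{X u | u ∈ U}`: at every point `q`, the
evaluations at `q` of the elements of the generated Lie algebra fill the whole tangent space. -/
def LieRankCondition {d : ℕ} {M U : Type*} [TopologicalSpace M]
    [ChartedSpace (EuclideanSpace ℝ (Fin d)) M]
    (X : U → ∀ q : M, TangentSpace (𝓡 d) q) : Prop :=
  ∀ (q : M) (v : TangentSpace (𝓡 d) q), ∃ Y ∈ lieHull (Set.range X), Y q = v

end LieAlgebra

section Signals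

/-- `u|_[0,T]` is the concatenation of finitely many (at least one) constant signals, each of
length at least `τ`: the pieces occupy the intervals `(s i, s (i+1)]`, `i < m`, of a subdivision
of `[0,T]`. The value at the initial time `0` is irrelevant (it does not influence trajectories),
so that a signal may be restricted to the intervals on both sides of a switching time. -/
def IsDwellSignal {U : Type*} (τ T : ℝ) (u : ℝ → U) : Prop :=
  ∃ (m : ℕ) (s : ℕ → ℝ) (v : ℕ → U), 0 < m ∧ s 0 = 0 ∧ s m = T ∧
    ∀ i < m, s i ≤ s (i + 1) ∧ τ ≤ s (i + 1) - s i ∧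
      ∀ t ∈ Set.Ioc (s i) (s (i + 1)), u t = v i

/-- `u : [0,∞) → U` is a dwell-time signal of infinite duration: there are times `T n → ∞` such
that each `u|_[0,T n]` is a dwell-time signal. -/
def IsDwellSignalInfty {U : Type*} (τ : ℝ) (u : ℝ → U) : Prop :=
  ∃ T : ℕ → ℝ, Filter.Tendsto T Filter.atTop Filter.atTop ∧ ∀ n, IsDwellSignal τ (T n) u

/-- The signal `u|_[t,∞)`, translated so as to start at time `0`. -/
def shift {U : Type*} (t : ℝ) (u : ℝ → U) : ℝ → U := fun s => u (s + t)

end Signals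

section ControlSets

/-- `γ` is a trajectory on the time interval `J` of `q' = X(q, u(t))`, for a piecewise constant
signal `u` (continuous from the left): on every closed interval `[a,b] ⊆ J` such that `u` is equal
to a constant `v` on `(a,b]`, `γ` is an integral curve of the vector field `X v`. In particular
`γ` is continuous at the switching times. -/
def IsTrajectoryOn {d : ℕ} {M U : Type*} [TopologicalSpace M]
    [ChartedSpace (EuclideanSpace ℝ (Fin d)) M]
    (X : U → ∀ q : M, TangentSpace (𝓡 d) q) (u : ℝ → U) (γ : ℝ → M) (J : Set ℝ) : Prop :=
  ∀ (a b : ℝ) (v : U), a < b → Set.Icc a b ⊆ J → (∀ t ∈ Set.Ioc a b, u t = v) →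
    IsMIntegralCurveOn γ (X v) (Set.Icc a b)

/-- The set of all maps `q ↦ φ(T(u), q, u)`, where `u` ranges over the dwell-time signals and
`φ(·, q, u)` is the trajectory starting at `q` driven by `u`. -/
def dwellSemigroup {d : ℕ} {M U : Type*} [TopologicalSpace M]
    [ChartedSpace (EuclideanSpace ℝ (Fin d)) M]
    (X : U → ∀ q : M, TangentSpace (𝓡 d) q) (τ : ℝ) : Set (M → M) :=
  {g | ∃ (T : ℝ) (u : ℝ → U), IsDwellSignal τ T u ∧
    ∀ q, ∃ γ : ℝ → M, IsTrajectoryOn X u γ (Set.Icc 0 T) ∧ γ 0 = q ∧ γ T = g q}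

/-- The orbit of `q` under the dwell-time semigroup. -/
def dwellOrbit {d : ℕ} {M U : Type*} [TopologicalSpace M]
    [ChartedSpace (EuclideanSpace ℝ (Fin d)) M]
    (X : U → ∀ q : M, TangentSpace (𝓡 d) q) (τ : ℝ) (q : M) : Set M :=
  {p | ∃ g ∈ dwellSemigroup X τ, g q = p}

/-- Condition (i): from every point of `D` starts a trajectory driven by a dwell-time signal of
infinite duration that is in `D` at every time `t > 0` at which the signal splits into two
dwell-time signals. -/
def StaysAtSplitTimes {d : ℕ} {M U : Type*} [TopologicalSpace M]
    [ChartedSpace (EuclideanSpace ℝ (Fin d)) M]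
    (X : U → ∀ q : M, TangentSpace (𝓡 d) q) (τ : ℝ) (D : Set M) : Prop :=
  ∀ q ∈ D, ∃ (u : ℝ → U) (γ : ℝ → M), IsDwellSignalInfty τ u ∧
    IsTrajectoryOn X u γ (Set.Ici 0) ∧ γ 0 = q ∧
    ∀ t > 0, IsDwellSignal τ t u → IsDwellSignalInfty τ (shift t u) → γ t ∈ D

/-- Condition (ii): approximate controllability inside `D`. -/
def ApproxControllable {d : ℕ} {M U : Type*} [TopologicalSpace M]
    [ChartedSpace (EuclideanSpace ℝ (Fin d)) M]
    (X : U → ∀ q : M, TangentSpace (𝓡 d) q) (τ : ℝ) (D : Set M) : Prop :=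
  ∀ q ∈ D, D ⊆ closure (dwellOrbit X τ q)

/-- `τ` dwell-time control sets: the sets that satisfy (i) and (ii) and are maximal with these
two properties. -/
def IsControlSet {d : ℕ} {M U : Type*} [TopologicalSpace M]
    [ChartedSpace (EuclideanSpace ℝ (Fin d)) M]
    (X : U → ∀ q : M, TangentSpace (𝓡 d) q) (τ : ℝ) (D : Set M) : Prop :=
  StaysAtSplitTimes X τ D ∧ ApproxControllable X τ D ∧
    ∀ D' : Set M, D ⊆ D' → StaysAtSplitTimes X τ D' → ApproxControllable X τ D' → D' = D

/-- Invariant `τ` dwell-time control sets. -/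
def IsInvariantControlSet {d : ℕ} {M U : Type*} [TopologicalSpace M]
    [ChartedSpace (EuclideanSpace ℝ (Fin d)) M]
    (X : U → ∀ q : M, TangentSpace (𝓡 d) q) (τ : ℝ) (D : Set M) : Prop :=
  IsControlSet X τ D ∧ ∀ q ∈ D, closure D = closure (dwellOrbit X τ q)

end ControlSets

end DwellTime

/-! # Finiteness of the number of invariant dwell-time control sets

Two invariant control sets coincide as soon as orbits of points of theirs have a nonempty open set
in common: the closure of an invariant control set is the closure of the orbit of each of its points,
so that the two closures agree; then the union of the two sets satisfies both defining properties,
and maximality makes them equal (`IsInvariantControlSet.eq_of_subset_orbits`). By compactness of `M`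
it is therefore enough that every point `q` has a neighbourhood all of whose points reach one and the
same nonempty open set (`finite_isInvariantControlSet`).

Such an open set comes from a variant of Krener's accessibility argument that does not need short
times. Consider families of reachable points `x ↦ F (x, q)`, with `F (x, ·)` in the semigroup and `F`
smooth, that are immersions near some parameter. If some `X v` is transversal to the family at a
point, then flowing along `X v`, for any duration, gives an immersion with one more parameter
(`injective_mfderiv_flow`): since `X v` is invariant under its own flow, transversality at the
starting point is preserved for all times, and the durations may be taken larger than `τ`. If no
`X v` is transversal, then all elements of the generated Lie algebra are tangent to the family
(`lieHull_tangent`) and the rank condition makes it a submersion. As the dimension of an immersion is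
at most that of `M`, a submersion `x ↦ F (x, q)` exists (`hasReachableSubmersion`). Then the map
`(x, q') ↦ (q', F (x, q'))` is open near `q`, so that the same open set is reached from all nearby
points (`HasReachableSubmersion.exists_isOpen_subset_dwellOrbit`).

The argument uses that flows are smooth in time and initial point jointly (`contMDiff_flow`). Locally
this follows from the implicit function theorem for the integral equation on a space of continuous
curves, where postcomposition with a smooth map is a smooth operator (`contDiff_postcomp`).
-/

/-! ### The composition operator on spaces of continuous curves -/

namespace DwellTime

open Set Filter Topology

section Curves

universe u

variable {K : Type*} [TopologicalSpace K] [CompactSpace K]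
  {E F : Type*} [NormedAddCommGroup E] [NormedSpace ℝ E] [NormedAddCommGroup F] [NormedSpace ℝ F]

/-- Pointwise application of a continuous family of continuous linear maps to a curve, as a
continuous bilinear map. -/
noncomputable def pointwiseApply (K E F : Type*) [TopologicalSpace K] [CompactSpace K]
    [NormedAddCommGroup E] [NormedSpace ℝ E] [NormedAddCommGroup F] [NormedSpace ℝ F] :
    C(K, E →L[ℝ] F) →L[ℝ] C(K, E) →L[ℝ] C(K, F) :=
  LinearMap.mkContinuous₂
    (LinearMap.mk₂ ℝ (fun (A : C(K, E →L[ℝ] F)) (h : C(K, E)) =>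
        (⟨fun t => A t (h t), A.continuous.clm_apply h.continuous⟩ : C(K, F)))
      (fun _ _ _ => by ext; simp) (fun _ _ _ => by ext; simp)
      (fun _ _ _ => by ext; simp) (fun _ _ _ => by ext; simp)) 1
    (fun A h => by
      rw [ContinuousMap.norm_le _ (by positivity)]
      intro t
      rw [one_mul]
      refine (ContinuousLinearMap.le_opNorm (A t) (h t)).trans ?_
      gcongr
      exacts [A.norm_coe_le_norm t, h.norm_coe_le_norm t])

@[simp]
theorem pointwiseApply_apply (A : C(K, E →L[ℝ] F)) (h : C(K, E)) (t : K) :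
    pointwiseApply K E F A h t = A t (h t) := rfl

theorem hasFDerivAt_postcomp (f : C(E, F)) (f' : C(E, E →L[ℝ] F))
    (hf : ∀ x, HasFDerivAt f (f' x) x) (γ : C(K, E)) :
    HasFDerivAt (fun γ : C(K, E) => f.comp γ) (pointwiseApply K E F (f'.comp γ)) γ := by
  rw [hasFDerivAt_iff_isLittleO, Asymptotics.isLittleO_iff]
  intro ε hε
  have hcont : Continuous fun γ : C(K, E) => f'.comp γ := f'.continuous_postcomp
  obtain ⟨δ, hδ, hball⟩ := (Metric.continuous_iff (β := C(K, E →L[ℝ] F))).1 hcont γ ε hε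
  filter_upwards [Metric.ball_mem_nhds γ hδ] with η hη
  rw [ContinuousMap.norm_le _ (by positivity)]
  intro t
  -- the modulus of continuity of `f'` along `γ`, read off from the constant perturbations of `γ`
  have hbound : ∀ y ∈ Metric.ball (γ t) δ, ‖f' y - f' (γ t)‖ ≤ ε := by
    intro y hy
    have h1 : dist (γ + ContinuousMap.const K (y - γ t)) γ < δ := by
      rw [dist_eq_norm, add_sub_cancel_left]
      refine lt_of_le_of_lt ((ContinuousMap.norm_le _ (norm_nonneg (y - γ t))).2 fun s => ?_)
        (by rwa [Metric.mem_ball, dist_eq_norm] at hy)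
      simp
    have h2 := (ContinuousMap.dist_apply_le_dist t).trans (hball _ h1).le
    simpa [dist_eq_norm] using h2
  have hηt : η t ∈ Metric.ball (γ t) δ :=
    (ContinuousMap.dist_apply_le_dist t).trans_lt hη
  have h3 := (convex_ball (γ t) δ).norm_image_sub_le_of_norm_hasFDerivWithin_le'
    (fun y _ => (hf y).hasFDerivWithinAt) hbound (Metric.mem_ball_self hδ) hηt
  refine (le_of_eq ?_).trans (h3.trans ?_)
  · simp
  · exact mul_le_mul_of_nonneg_left ((η - γ).norm_coe_le_norm t) hε.le

/-- Postcomposition with a `C^n` map is a `C^n` map between spaces of continuous curves. -/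
theorem contDiff_postcomp {E : Type u} [NormedAddCommGroup E] [NormedSpace ℝ E] (n : ℕ) :
    ∀ {F : Type u} [NormedAddCommGroup F] [NormedSpace ℝ F] (f : C(E, F)), ContDiff ℝ n f →
      ContDiff ℝ n (fun γ : C(K, E) => f.comp γ) := by
  induction n with
  | zero =>
    intro F _ _ f _
    exact contDiff_zero.2 f.continuous_postcomp
  | succ n ih =>
    intro F _ _ f hf
    have hf1 := (contDiff_succ_iff_fderiv (n := (n : WithTop ℕ∞))).1 (by exact_mod_cast hf)
    have hd := hasFDerivAt_postcomp (K := K) f ⟨fderiv ℝ f, hf1.2.2.continuous⟩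
      (fun x => (hf1.1 x).hasFDerivAt)
    have : ContDiff ℝ ((n : WithTop ℕ∞) + 1) (fun γ : C(K, E) => f.comp γ) := by
      refine contDiff_succ_iff_fderiv.2 ⟨fun γ => (hd γ).differentiableAt, by simp, ?_⟩
      have : fderiv ℝ (fun γ : C(K, E) => f.comp γ) = fun γ =>
          pointwiseApply K E F (ContinuousMap.comp ⟨fderiv ℝ f, hf1.2.2.continuous⟩ γ) :=
        funext fun γ => (hd γ).fderiv
      rw [this]
      exact (pointwiseApply K E F).contDiff.comp (ih ⟨fderiv ℝ f, hf1.2.2.continuous⟩ hf1.2.2)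
    exact_mod_cast this

/-- The operator sending a curve `γ` on `[-2, 2]` to the curve `t ↦ ∫ s in 0..t, γ s`. The interval
`[-2, 2]` contains both `0` and `1` in its interior. -/
noncomputable def curvePrimitive (E : Type*) [NormedAddCommGroup E] [NormedSpace ℝ E] :
    C(Icc (-2 : ℝ) 2, E) →L[ℝ] C(Icc (-2 : ℝ) 2, E) :=
  LinearMap.mkContinuous
    { toFun := fun γ => ⟨fun t => ∫ s in (0 : ℝ)..t, γ (projIcc (-2) 2 (by norm_num) s), by
        have hc : Continuous fun s : ℝ => γ (projIcc (-2) 2 (by norm_num) s) :=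
          γ.continuous.comp continuous_projIcc
        exact (intervalIntegral.continuous_primitive
          (fun a b => hc.intervalIntegrable a b) 0).comp continuous_subtype_val⟩
      map_add' := fun γ η => by
        ext t
        have hc : ∀ γ : C(Icc (-2 : ℝ) 2, E),
            Continuous fun s : ℝ => γ (projIcc (-2) 2 (by norm_num) s) :=
          fun γ => γ.continuous.comp continuous_projIcc
        exact intervalIntegral.integral_add ((hc γ).intervalIntegrable _ _)
          ((hc η).intervalIntegrable _ _)
      map_smul' := fun c γ => by
        ext t
        exact intervalIntegral.integral_smul c _ } 2
    (fun γ => by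
      rw [ContinuousMap.norm_le _ (by positivity)]
      intro t
      refine (intervalIntegral.norm_integral_le_of_norm_le_const
        (fun s _ => γ.norm_coe_le_norm _)).trans ?_
      rw [mul_comm, sub_zero]
      exact mul_le_mul_of_nonneg_right (abs_le.2 t.2) (norm_nonneg _))

theorem curvePrimitive_apply (γ : C(Icc (-2 : ℝ) 2, E)) (t : Icc (-2 : ℝ) 2) :
    curvePrimitive E γ t = ∫ s in (0 : ℝ)..t, γ (projIcc (-2) 2 (by norm_num) s) := rfl

/-- Smooth dependence of the solutions of `y' = s f(y)`, `y(0) = x` on `(s, x)` near `(0, x₀)`. With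
the factor `s` the time interval stays fixed, so that the solution on it is given by the
implicit function theorem applied to the integral equation in the space of continuous curves; the
linearization at `s = 0` is the identity. The value at time `1` is the time-`s` flow of `f`. -/
theorem exists_contDiffAt_local_flow {E : Type u} [NormedAddCommGroup E] [NormedSpace ℝ E]
    [CompleteSpace E] {n : ℕ} (hn : n ≠ 0) {f : E → E} (hf : ContDiff ℝ n f) (x₀ : E)
    {V : Set E} (hV : V ∈ 𝓝 x₀) :
    ∃ φ : ℝ × E → E, ContDiffAt ℝ n φ (0, x₀) ∧ φ (0, x₀) = x₀ ∧ ∀ᶠ p in 𝓝 ((0 : ℝ), x₀),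
      ∃ η : ℝ → E, η 0 = p.2 ∧ η 1 = φ p ∧
        ∀ t ∈ Ioo (-2 : ℝ) 2, η t ∈ V ∧ HasDerivAt η (p.1 • f (η t)) t := by
  let I : Set ℝ := Icc (-2 : ℝ) 2
  let f0 : C(E, E) := ⟨f, hf.continuous⟩
  let constL : E →L[ℝ] C(I, E) := LinearMap.mkContinuous
    { toFun := ContinuousMap.const I
      map_add' := fun _ _ => rfl
      map_smul' := fun _ _ => rfl } 1
    (fun y => (ContinuousMap.norm_le _ (by positivity)).2 fun _ => (one_mul ‖y‖).ge)
  have hconstL : ∀ y t, constL y t = y := fun _ _ => rfl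
  let G : (ℝ × E) × C(I, E) → C(I, E) := fun p =>
    p.2 - constL p.1.2 - p.1.1 • curvePrimitive E (f0.comp p.2)
  have hcomp : ContDiff ℝ n (fun γ : C(I, E) => f0.comp γ) := contDiff_postcomp n f0 hf
  have hG : ContDiff ℝ n G := by
    refine (contDiff_snd.sub (constL.contDiff.comp (contDiff_snd.comp contDiff_fst))).sub
      ((contDiff_fst.comp contDiff_fst).smul
        ((curvePrimitive E).contDiff.comp (hcomp.comp contDiff_snd)))
  let u : (ℝ × E) × C(I, E) := ((0, x₀), constL x₀)
  have hn' : (n : WithTop ℕ∞) ≠ 0 := by exact_mod_cast hn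
  have hinv : fderiv ℝ G u ∘L .inr ℝ (ℝ × E) C(I, E) = ContinuousLinearMap.id ℝ _ := by
    have h1 : HasFDerivAt (fun γ : C(I, E) => G ((0, x₀), γ))
        (fderiv ℝ G u ∘L .inr ℝ (ℝ × E) C(I, E)) (constL x₀) := by
      have h2 : HasFDerivAt G (fderiv ℝ G u) ((0, x₀), constL x₀) :=
        ((hG.differentiable hn') u).hasFDerivAt
      exact h2.comp (constL x₀) (hasFDerivAt_prodMk_right (0, x₀) (constL x₀))
    have h3 : HasFDerivAt (fun γ : C(I, E) => G ((0, x₀), γ))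
        (ContinuousLinearMap.id ℝ _) (constL x₀) := by
      have : (fun γ : C(I, E) => G ((0, x₀), γ)) = fun γ => id γ - constL x₀ := by
        funext γ
        simp [G]
      rw [this]
      exact (hasFDerivAt_id _).sub_const _
    exact h1.unique h3
  have hI : (fderiv ℝ G u ∘L .inr ℝ (ℝ × E) C(I, E)).IsInvertible := by
    rw [hinv]
    exact ⟨ContinuousLinearEquiv.refl ℝ _, rfl⟩
  have hGu : G u = 0 := by simp [G, u]
  let ψ := (hG.contDiffAt (x := u)).implicitFunction hn' hI
  have hψ : ContDiffAt ℝ n ψ (0, x₀) := (hG.contDiffAt (x := u)).contDiffAt_implicitFunction hn' hI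
  have hψ0 : ψ (0, x₀) = constL x₀ :=
    (hG.contDiffAt (x := u)).implicitFunction_apply_self hn' hI
  have hψG : ∀ᶠ p in 𝓝 ((0 : ℝ), x₀), G (p, ψ p) = 0 := by
    filter_upwards [(hG.contDiffAt (x := u)).eventually_apply_implicitFunction hn' hI] with p hp
    exact hp.trans hGu
  let one : I := ⟨1, by norm_num [I]⟩
  refine ⟨fun p => ψ p one, ?_, ?_, ?_⟩
  · exact (ContinuousMap.evalCLM ℝ one).contDiff.contDiffAt.comp _ hψ
  · beta_reduce
    rw [hψ0, hconstL]
  obtain ⟨r, hr, hrV⟩ := Metric.mem_nhds_iff.1 hV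
  have hclose : ∀ᶠ p in 𝓝 ((0 : ℝ), x₀), ψ p ∈ Metric.ball (constL x₀) r := by
    refine hψ.continuousAt.eventually_mem ?_
    rw [hψ0]
    exact Metric.ball_mem_nhds _ hr
  filter_upwards [hψG, hclose] with p hp hpr
  have hpc : Continuous fun s : ℝ => f (ψ p (projIcc (-2) 2 (by norm_num) s)) :=
    hf.continuous.comp ((ψ p).continuous.comp continuous_projIcc)
  have heq : ∀ t : I, ψ p t = p.2 + p.1 • ∫ s in (0 : ℝ)..t,
      f (ψ p (projIcc (-2) 2 (by norm_num) s)) := by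
    intro t
    have h := DFunLike.congr_fun hp t
    have h' : ψ p t - p.2 - p.1 • curvePrimitive E (f0.comp (ψ p)) t = 0 := by
      simpa [G, hconstL] using h
    rw [sub_sub, sub_eq_zero] at h'
    exact h'
  refine ⟨fun t => p.2 + p.1 • ∫ s in (0 : ℝ)..t, f (ψ p (projIcc (-2) 2 (by norm_num) s)),
    by simp, (heq one).symm, fun t ht => ?_⟩
  have htI : t ∈ I := ⟨ht.1.le, ht.2.le⟩
  have hηt : ψ p ⟨t, htI⟩ = p.2 + p.1 • ∫ s in (0 : ℝ)..t,
      f (ψ p (projIcc (-2) 2 (by norm_num) s)) := heq ⟨t, htI⟩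
  constructor
  · beta_reduce
    rw [← hηt]
    have := (ContinuousMap.dist_apply_le_dist (f := ψ p) (g := constL x₀) ⟨t, htI⟩).trans_lt hpr
    rw [hconstL] at this
    exact hrV this
  · have hd := ((intervalIntegral.integral_hasDerivAt_right (hpc.intervalIntegrable 0 t)
      (hpc.stronglyMeasurableAtFilter _ _) hpc.continuousAt).const_smul p.1).const_add p.2
    rw [projIcc_of_mem _ htI, hηt] at hd
    exact hd

end Curves

/-! ### Smoothness of complete flows on compact manifolds -/

section SmoothFlow

/-- The germ of a `C^n` map has a globally `C^n` representative, by means of a bump function. -/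
theorem exists_contDiff_eventuallyEq {E F : Type*} [NormedAddCommGroup E] [NormedSpace ℝ E]
    [FiniteDimensional ℝ E] [NormedAddCommGroup F] [NormedSpace ℝ F] {n : ℕ} {f : E → F} {x : E}
    (hf : ContDiffAt ℝ n f x) : ∃ g : E → F, ContDiff ℝ n g ∧ g =ᶠ[𝓝 x] f := by
  obtain ⟨r, hr, hball⟩ := Metric.eventually_nhds_iff_ball.1 (hf.eventually (by simp))
  let χ : ContDiffBump x := ⟨r / 4, r / 2, by positivity, by linarith⟩
  refine ⟨fun y => χ y • f y, ?_, ?_⟩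
  · rw [contDiff_iff_contDiffAt]
    intro y
    by_cases hy : y ∈ Metric.ball x r
    · exact χ.contDiff.contDiffAt.smul (hball y hy)
    · have h0 : (fun y => χ y • f y) =ᶠ[𝓝 y] fun _ => 0 := by
        have hy' : y ∈ (tsupport χ)ᶜ := by
          rw [χ.tsupport_eq]
          intro h
          refine hy (Metric.closedBall_subset_ball ?_ h)
          change r / 2 < r
          linarith
        filter_upwards [(isClosed_tsupport _).isOpen_compl.mem_nhds hy'] with z hz
        rw [image_eq_zero_of_notMem_tsupport hz, zero_smul]
      exact contDiffAt_const.congr_of_eventuallyEq h0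
  · filter_upwards [χ.eventuallyEq_one] with y hy
    rw [hy, Pi.one_apply, one_smul]

variable {d : ℕ} {M : Type*} [TopologicalSpace M] [ChartedSpace (EuclideanSpace ℝ (Fin d)) M]

section Lift

variable [IsManifold (𝓡 d) 1 M]

/-- A curve in a chart that solves the differential equation of the coordinate expression of `V`,
multiplied by `s`, is the coordinate expression of an integral curve of `s • V`. -/
theorem hasMFDerivAt_extChartAt_symm_comp (V : ∀ q : M, TangentSpace (𝓡 d) q) (q₀ : M)
    {η : ℝ → EuclideanSpace ℝ (Fin d)} {s t : ℝ} (ht : η t ∈ (extChartAt (𝓡 d) q₀).target)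
    (hη : HasDerivAt η ((s • tangentCoordChange (𝓡 d) ((extChartAt (𝓡 d) q₀).symm (η t)) q₀
      ((extChartAt (𝓡 d) q₀).symm (η t)) (V ((extChartAt (𝓡 d) q₀).symm (η t))) :
        EuclideanSpace ℝ (Fin d))) t) :
    HasMFDerivAt 𝓘(ℝ, ℝ) (𝓡 d) ((extChartAt (𝓡 d) q₀).symm ∘ η) t
      ((1 : ℝ →L[ℝ] ℝ).smulRight ((s • V) ((extChartAt (𝓡 d) q₀).symm (η t)))) := by
  set p : M := (extChartAt (𝓡 d) q₀).symm (η t) with hp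
  have hp1 : p ∈ (extChartAt (𝓡 d) q₀).source := (extChartAt (𝓡 d) q₀).map_target ht
  have hp2 := mem_extChartAt_source (I := 𝓡 d) p
  have hd : HasDerivAt ((extChartAt (𝓡 d) p ∘ (extChartAt (𝓡 d) q₀).symm) ∘ η)
      (s • V p : EuclideanSpace ℝ (Fin d)) t := by
    have h1 : (s • V p : EuclideanSpace ℝ (Fin d)) =
        tangentCoordChange (𝓡 d) q₀ p p (s • tangentCoordChange (𝓡 d) p q₀ p (V p)) := by
      have h2 : ∀ w : EuclideanSpace ℝ (Fin d), tangentCoordChange (𝓡 d) q₀ p p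
          (tangentCoordChange (𝓡 d) p q₀ p w) = w := fun w => by
        rw [tangentCoordChange_comp (x := q₀) ⟨⟨hp2, hp1⟩, hp2⟩,
          tangentCoordChange_self (I := 𝓡 d) hp2]
      rw [map_smul]
      exact congrArg (s • ·) (h2 (V p)).symm
    rw [h1]
    refine HasFDerivAt.comp_hasDerivAt _ ?_ hη
    have := hasFDerivWithinAt_tangentCoordChange (I := 𝓡 d) ⟨hp1, hp2⟩
    rw [hp, (extChartAt (𝓡 d) q₀).right_inv ht, ← hp] at this
    simpa using this
  refine ⟨(continuousAt_extChartAt_symm'' ht).comp hη.continuousAt, ?_⟩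
  exact hd.hasFDerivAt.hasFDerivWithinAt

end Lift

variable [IsManifold (𝓡 d) ∞ M] [T2Space M]

theorem flow_add {V : ∀ q : M, TangentSpace (𝓡 d) q}
    (hV : ContMDiff (𝓡 d) (𝓡 d).tangent ∞ (fun q => (⟨q, V q⟩ : TangentBundle (𝓡 d) M)))
    {Φ : ℝ → M → M} (h0 : ∀ q, Φ 0 q = q) (hΦ : ∀ q, IsMIntegralCurve (fun t => Φ t q) V)
    (s t : ℝ) (q : M) : Φ (s + t) q = Φ s (Φ t q) := by
  have : IsManifold (𝓡 d) 1 M := IsManifold.of_le (n := ∞) (by simp)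
  have := isMIntegralCurve_Ioo_eq_of_contMDiff_boundaryless (t₀ := 0) (hV.of_le (by simp))
    ((hΦ q).comp_add t) (hΦ (Φ t q)) (by simp [h0])
  exact congrFun this s

/-- Near time `0` the flow is, in a chart, the local flow of the coordinate expression of the vector
field, cut off away from the base point. -/
theorem contMDiffAt_flow_zero {V : ∀ q : M, TangentSpace (𝓡 d) q}
    (hV : ContMDiff (𝓡 d) (𝓡 d).tangent ∞ (fun q => (⟨q, V q⟩ : TangentBundle (𝓡 d) M)))
    {Φ : ℝ → M → M} (h0 : ∀ q, Φ 0 q = q) (hΦ : ∀ q, IsMIntegralCurve (fun t => Φ t q) V)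
    {n : ℕ} (hn : n ≠ 0) (q₀ : M) :
    ContMDiffAt (𝓘(ℝ, ℝ).prod (𝓡 d)) (𝓡 d) n (fun p : ℝ × M => Φ p.1 p.2) (0, q₀) := by
  have : IsManifold (𝓡 d) 1 M := IsManifold.of_le (n := ∞) (by simp)
  have : IsManifold (𝓡 d) n M := IsManifold.of_le (n := ∞) (by exact_mod_cast le_top)
  have hV1 := hV.of_le (n := ∞) (m := 1) (by simp)
  let ψ := extChartAt (𝓡 d) q₀
  have hc := (contMDiffAt_iff.1 (hV.contMDiffAt (x := q₀))).2.snd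
  have hf0 : ContDiffAt ℝ n (fun y : EuclideanSpace ℝ (Fin d) =>
      tangentCoordChange (𝓡 d) (ψ.symm y) q₀ (ψ.symm y) (V (ψ.symm y))) (ψ q₀) := by
    have := (hc.contDiffAt (by simp)).of_le (m := n) (by exact_mod_cast le_top)
    exact this
  obtain ⟨f, hf, hff⟩ := exists_contDiff_eventuallyEq hf0
  have htarget : ψ.target ∈ 𝓝 (ψ q₀) := extChartAt_target_mem_nhds q₀
  obtain ⟨φ, hφ, hφ0, hflow⟩ := exists_contDiffAt_local_flow hn hf (ψ q₀) (inter_mem hff htarget)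
  have hψ : ContinuousAt (fun p : ℝ × M => ((p.1, ψ p.2) : ℝ × EuclideanSpace ℝ (Fin d)))
      (0, q₀) :=
    continuousAt_fst.prodMk ((continuousAt_extChartAt (I := 𝓡 d) q₀).comp (f := Prod.snd) (x := ((0 : ℝ), q₀))
      continuousAt_snd)
  have hsource : ∀ᶠ p : ℝ × M in 𝓝 (0, q₀), p.2 ∈ ψ.source :=
    continuousAt_snd.eventually_mem (extChartAt_source_mem_nhds q₀)
  have heq : (fun p : ℝ × M => Φ p.1 p.2) =ᶠ[𝓝 (0, q₀)] fun p => ψ.symm (φ (p.1, ψ p.2)) := by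
    filter_upwards [hψ.eventually hflow, hsource] with p ⟨η, hη0, hη1, hη⟩ hp
    have hcurve : IsMIntegralCurveOn (ψ.symm ∘ η) (p.1 • V) (Ioo (-2) 2) := by
      intro t ht
      obtain ⟨⟨hfη, htη⟩, hd⟩ := hη t ht
      rw [show f (η t) = _ from hfη] at hd
      exact (hasMFDerivAt_extChartAt_symm_comp V q₀ htη hd).hasMFDerivWithinAt
    have hflow' : IsMIntegralCurveOn ((fun t => Φ t p.2) ∘ (· * p.1)) (p.1 • V) (Ioo (-2) 2) :=
      ((hΦ p.2).comp_mul p.1).isMIntegralCurveOn _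
    have hsV : ContMDiff (𝓡 d) (𝓡 d).tangent 1
        (fun q => (⟨q, (p.1 • V) q⟩ : TangentBundle (𝓡 d) M)) := hV1.const_smul_section
    have := isMIntegralCurveOn_Ioo_eqOn_of_contMDiff_boundaryless (t₀ := 0) (by simp) hsV hflow'
      hcurve (by simp [h0, hη0, ψ.left_inv hp])
    have h1 := this (x := 1) (by norm_num)
    simpa [hη1] using h1
  refine ContMDiffAt.congr_of_eventuallyEq ?_ heq
  have h1 : ContMDiffAt (𝓘(ℝ, ℝ).prod (𝓡 d)) 𝓘(ℝ, ℝ × EuclideanSpace ℝ (Fin d)) n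
      (fun p : ℝ × M => ((p.1, ψ p.2) : ℝ × EuclideanSpace ℝ (Fin d))) (0, q₀) :=
    contMDiffAt_fst.prodMk_space ((contMDiffAt_extChartAt).comp (0, q₀) contMDiffAt_snd)
  have h2 : ContMDiffAt 𝓘(ℝ, EuclideanSpace ℝ (Fin d)) (𝓡 d) n ψ.symm (φ (0, ψ q₀)) := by
    rw [hφ0]
    exact (contMDiffOn_extChartAt_symm q₀).contMDiffAt htarget
  exact ContMDiffAt.comp (0, q₀) (g := fun x => ψ.symm (φ x))
    (f := fun p : ℝ × M => ((p.1, ψ p.2) : ℝ × EuclideanSpace ℝ (Fin d)))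
    (h2.comp (0, ψ q₀) hφ.contMDiffAt) h1

/-- The flow of a complete smooth vector field on a compact manifold is smooth in time and initial
point jointly. By compactness it is smooth on a uniform time interval, and it is a composition of
flows over short times. -/
theorem contMDiff_flow [CompactSpace M] {V : ∀ q : M, TangentSpace (𝓡 d) q}
    (hV : ContMDiff (𝓡 d) (𝓡 d).tangent ∞ (fun q => (⟨q, V q⟩ : TangentBundle (𝓡 d) M)))
    {Φ : ℝ → M → M} (h0 : ∀ q, Φ 0 q = q) (hΦ : ∀ q, IsMIntegralCurve (fun t => Φ t q) V) :
    ContMDiff (𝓘(ℝ, ℝ).prod (𝓡 d)) (𝓡 d) ∞ (fun p : ℝ × M => Φ p.1 p.2) := by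
  rw [contMDiff_infty]
  intro n
  suffices h : ContMDiff (𝓘(ℝ, ℝ).prod (𝓡 d)) (𝓡 d) (n + 1 : ℕ) (fun p : ℝ × M => Φ p.1 p.2) from
    h.of_le (by exact_mod_cast Nat.le_succ n)
  have : IsManifold (𝓡 d) (n + 1 : ℕ) M := IsManifold.of_le (n := ∞) (by exact_mod_cast le_top)
  have hloc : ∀ᶠ t in 𝓝 (0 : ℝ), ∀ q : M, ContMDiffAt (𝓘(ℝ, ℝ).prod (𝓡 d)) (𝓡 d) (n + 1 : ℕ)
      (fun p : ℝ × M => Φ p.1 p.2) (t, q) := by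
    have := isCompact_univ.eventually_forall_of_forall_eventually (x₀ := (0 : ℝ))
      (P := fun t q => ContMDiffAt (𝓘(ℝ, ℝ).prod (𝓡 d)) (𝓡 d) (n + 1 : ℕ)
        (fun p : ℝ × M => Φ p.1 p.2) (t, q)) (K := (univ : Set M)) fun q _ =>
      (contMDiffAt_iff_contMDiffAt_nhds (by simp)).1
        (contMDiffAt_flow_zero hV h0 hΦ n.succ_ne_zero q)
    simpa using this
  obtain ⟨ε, hε, hball⟩ := Metric.eventually_nhds_iff.1 hloc
  have hstep : ∀ k : ℕ, ∀ t : ℝ, |t| < (k + 1) * ε → ∀ q : M,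
      ContMDiffAt (𝓘(ℝ, ℝ).prod (𝓡 d)) (𝓡 d) (n + 1 : ℕ) (fun p : ℝ × M => Φ p.1 p.2) (t, q) := by
    intro k
    induction k with
    | zero => exact fun t ht => hball (by simpa using ht)
    | succ k ih =>
      intro t ht q
      have hk : (0 : ℝ) < k + 1 := by positivity
      have hk' : (0 : ℝ) < k + 2 := by positivity
      -- split time `t` into `t / (k + 2)`, of size less than `ε`, and the rest, covered by induction
      let a : ℝ := 1 / (k + 2)
      let b : ℝ := (k + 1) / (k + 2)
      have hab : a + b = 1 := by
        simp only [a, b]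
        field_simp
        ring
      have hta : |a * t| < ε := by
        rw [abs_mul, abs_of_pos (by positivity : 0 < a), div_mul_eq_mul_div, one_mul, div_lt_iff₀ hk']
        push_cast at ht
        linarith
      have htb : |b * t| < (k + 1) * ε := by
        rw [abs_mul, abs_of_pos (by positivity : 0 < b), div_mul_eq_mul_div, div_lt_iff₀ hk']
        push_cast at ht
        nlinarith
      have heq : (fun p : ℝ × M => Φ p.1 p.2) = fun p => Φ (a * p.1) (Φ (b * p.1) p.2) := by
        funext p
        rw [← flow_add hV h0 hΦ, ← add_mul, hab, one_mul]
      rw [heq]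
      have hmul : ∀ c : ℝ, ContMDiffAt (𝓘(ℝ, ℝ).prod (𝓡 d)) 𝓘(ℝ, ℝ) (n + 1 : ℕ)
          (fun p : ℝ × M => c * p.1) (t, q) := fun c =>
        ((contDiff_const.mul contDiff_id).contMDiff (n := (n + 1 : ℕ)) (f := fun x : ℝ => c * x)
          ).contMDiffAt.comp (t, q) contMDiffAt_fst
      have hin : ContMDiffAt (𝓘(ℝ, ℝ).prod (𝓡 d)) (𝓡 d) (n + 1 : ℕ)
          (fun p : ℝ × M => Φ (b * p.1) p.2) (t, q) :=
        ContMDiffAt.comp (t, q) (g := fun p : ℝ × M => Φ p.1 p.2)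
          (f := fun p : ℝ × M => (b * p.1, p.2)) (ih _ htb q) ((hmul b).prodMk contMDiffAt_snd)
      exact ContMDiffAt.comp (t, q) (g := fun p : ℝ × M => Φ p.1 p.2)
          (f := fun p : ℝ × M => (a * p.1, Φ (b * p.1) p.2)) (hball (by simpa using hta) _)
          ((hmul a).prodMk hin)
  rintro ⟨t, q⟩
  obtain ⟨k, hk⟩ := exists_nat_gt (|t| / ε)
  exact hstep k t (by rw [div_lt_iff₀ hε] at hk; linarith) q

end SmoothFlow

/-! ### The dwell-time semigroup -/

section Semigroup

theorem IsDwellSignal.nonneg {U : Type*} {τ T : ℝ} {u : ℝ → U} (h : IsDwellSignal τ T u) :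
    0 ≤ T := by
  obtain ⟨m, s, v, -, h0, hT, h⟩ := h
  have : ∀ i ≤ m, 0 ≤ s i := by
    intro i
    induction i with
    | zero => exact fun _ => h0.ge
    | succ i ih => exact fun hi => (ih (by omega)).trans (h i (by omega)).1
  exact hT ▸ this m le_rfl

/-- Concatenation at time `T` of two functions of time. -/
noncomputable def concat {A : Type*} (T : ℝ) (f g : ℝ → A) : ℝ → A :=
  fun t => if t ≤ T then f t else g (t - T)

theorem concat_of_le {A : Type*} {T t : ℝ} (f g : ℝ → A) (h : t ≤ T) : concat T f g t = f t :=
  if_pos h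

theorem concat_of_lt {A : Type*} {T t : ℝ} (f g : ℝ → A) (h : T < t) :
    concat T f g t = g (t - T) := if_neg h.not_ge

theorem concat_of_ge {A : Type*} {T t : ℝ} {f g : ℝ → A} (hfg : f T = g 0) (h : T ≤ t) :
    concat T f g t = g (t - T) := by
  rcases h.eq_or_lt with rfl | h
  · rw [concat_of_le _ _ le_rfl, hfg, sub_self]
  · exact concat_of_lt f g h

theorem IsDwellSignal.concat {U : Type*} {τ T₁ T₂ : ℝ} {u₁ u₂ : ℝ → U}
    (h₁ : IsDwellSignal τ T₁ u₁) (h₂ : IsDwellSignal τ T₂ u₂) :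
    IsDwellSignal τ (T₁ + T₂) (concat T₁ u₁ u₂) := by
  obtain ⟨m₁, s₁, v₁, hm₁, h01, hT1, h₁⟩ := h₁
  obtain ⟨m₂, s₂, v₂, hm₂, h02, hT2, h₂⟩ := h₂
  have hmono₁ : ∀ j ≤ m₁, s₁ j ≤ T₁ := by
    intro j hj
    induction hj using Nat.decreasingInduction with
    | self => exact hT1.le
    | of_succ k hk ih => exact (h₁ k (by omega)).1.trans ih
  have hmono₂ : ∀ j ≤ m₂, 0 ≤ s₂ j := by
    intro j
    induction j with
    | zero => exact fun _ => h02.ge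
    | succ j ih => exact fun hj => (ih (by omega)).trans (h₂ j (by omega)).1
  let s : ℕ → ℝ := fun i => if i ≤ m₁ then s₁ i else T₁ + s₂ (i - m₁)
  have hs1 : ∀ i ≤ m₁, s i = s₁ i := fun i hi => if_pos hi
  have hs2 : ∀ i, m₁ ≤ i → s i = T₁ + s₂ (i - m₁) := by
    intro i hi
    rcases hi.eq_or_lt with rfl | hi
    · rw [hs1 _ le_rfl, hT1, Nat.sub_self, h02, add_zero]
    · exact if_neg hi.not_ge
  refine ⟨m₁ + m₂, s, fun i => if i < m₁ then v₁ i else v₂ (i - m₁), by omega,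
    by rw [hs1 _ (Nat.zero_le _), h01], by rw [hs2 _ (by omega), Nat.add_sub_cancel_left, hT2],
    fun i hi => ?_⟩
  by_cases him : i < m₁
  · obtain ⟨ha, hb, hc⟩ := h₁ i him
    beta_reduce
    rw [hs1 i him.le, hs1 (i + 1) him, if_pos him]
    refine ⟨ha, hb, fun t ht => ?_⟩
    rw [concat_of_le _ _ (ht.2.trans (hmono₁ _ him)), hc t ht]
  · push Not at him
    obtain ⟨ha, hb, hc⟩ := h₂ (i - m₁) (by omega)
    beta_reduce
    rw [hs2 i him, hs2 (i + 1) (by omega), if_neg him.not_gt, show i + 1 - m₁ = i - m₁ + 1 by omega]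
    refine ⟨by linarith, by linarith, fun t ht => ?_⟩
    have h0 := hmono₂ (i - m₁) (by omega)
    rw [concat_of_lt _ _ (by linarith [ht.1]), hc (t - T₁) ⟨by linarith [ht.1], by linarith [ht.2]⟩]

variable {d : ℕ} {M U : Type*} [TopologicalSpace M] [ChartedSpace (EuclideanSpace ℝ (Fin d)) M]

theorem isMIntegralCurveOn_Icc_union {V : ∀ q : M, TangentSpace (𝓡 d) q} {γ : ℝ → M} {a b c : ℝ}
    (h₁ : IsMIntegralCurveOn γ V (Icc a c)) (h₂ : IsMIntegralCurveOn γ V (Icc c b))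
    (hac : a ≤ c) (hcb : c ≤ b) : IsMIntegralCurveOn γ V (Icc a b) := by
  intro t ht
  rcases lt_trichotomy t c with htc | rfl | htc
  · refine (h₁ t ⟨ht.1, htc.le⟩).mono_of_mem_nhdsWithin ?_
    filter_upwards [self_mem_nhdsWithin, mem_nhdsWithin_of_mem_nhds (Iio_mem_nhds htc)] with x hx hx'
    exact ⟨hx.1, le_of_lt hx'⟩
  · rw [← Icc_union_Icc_eq_Icc hac hcb]
    exact (h₁ t ⟨hac, le_rfl⟩).union (h₂ t ⟨le_rfl, hcb⟩)
  · refine (h₂ t ⟨htc.le, ht.2⟩).mono_of_mem_nhdsWithin ?_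
    filter_upwards [self_mem_nhdsWithin, mem_nhdsWithin_of_mem_nhds (Ioi_mem_nhds htc)] with x hx hx'
    exact ⟨le_of_lt hx', hx.2⟩

theorem isMIntegralCurveOn_congr {V : ∀ q : M, TangentSpace (𝓡 d) q} {γ γ' : ℝ → M} {s : Set ℝ}
    (h : IsMIntegralCurveOn γ V s) (heq : EqOn γ' γ s) : IsMIntegralCurveOn γ' V s := by
  intro t ht
  rw [heq ht]
  exact (h t ht).congr_of_eventuallyEq (eventually_mem_nhdsWithin.mono fun x hx => heq hx) (heq ht)

theorem IsTrajectoryOn.concat {X : U → ∀ q : M, TangentSpace (𝓡 d) q} {T₁ T₂ : ℝ}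
    {u₁ u₂ : ℝ → U} {γ₁ γ₂ : ℝ → M} (h₁ : IsTrajectoryOn X u₁ γ₁ (Icc 0 T₁))
    (h₂ : IsTrajectoryOn X u₂ γ₂ (Icc 0 T₂)) (h : γ₁ T₁ = γ₂ 0) :
    IsTrajectoryOn X (concat T₁ u₁ u₂) (concat T₁ γ₁ γ₂) (Icc 0 (T₁ + T₂)) := by
  have hleft : ∀ a b v, a < b → 0 ≤ a → b ≤ T₁ → (∀ t ∈ Ioc a b, DwellTime.concat T₁ u₁ u₂ t = v) →
      IsMIntegralCurveOn (DwellTime.concat T₁ γ₁ γ₂) (X v) (Icc a b) := by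
    intro a b v hab ha hb hu
    refine isMIntegralCurveOn_congr (h₁ a b v hab (Icc_subset_Icc ha hb) fun t ht => ?_) fun t ht =>
      concat_of_le γ₁ γ₂ (ht.2.trans hb)
    rw [← hu t ht, concat_of_le _ _ (ht.2.trans hb)]
  have hright : ∀ a b v, a < b → T₁ ≤ a → b ≤ T₁ + T₂ →
      (∀ t ∈ Ioc a b, DwellTime.concat T₁ u₁ u₂ t = v) →
      IsMIntegralCurveOn (DwellTime.concat T₁ γ₁ γ₂) (X v) (Icc a b) := by
    intro a b v hab ha hb hu
    have h3 := h₂ (a - T₁) (b - T₁) v (by linarith)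
      (Icc_subset_Icc (by linarith) (by linarith)) fun t ht => by
        rw [← hu (t + T₁) ⟨by linarith [ht.1], by linarith [ht.2]⟩,
          concat_of_lt _ _ (by linarith [ht.1]), add_sub_cancel_right]
    refine isMIntegralCurveOn_congr ((h3.comp_add (-T₁)).mono ?_) fun t ht =>
      concat_of_ge h (ha.trans ht.1)
    intro t ht
    exact ⟨by linarith [ht.1], by linarith [ht.2]⟩
  intro a b v hab hJ hu
  have ha : 0 ≤ a := (hJ (left_mem_Icc.2 hab.le)).1
  have hb : b ≤ T₁ + T₂ := (hJ (right_mem_Icc.2 hab.le)).2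
  rcases le_or_gt b T₁ with hbT | hbT
  · exact hleft a b v hab ha hbT hu
  rcases le_or_gt T₁ a with haT | haT
  · exact hright a b v hab haT hb hu
  · exact isMIntegralCurveOn_Icc_union
      (hleft a T₁ v haT ha le_rfl fun t ht => hu t ⟨ht.1, ht.2.trans hbT.le⟩)
      (hright T₁ b v hbT le_rfl hb fun t ht => hu t ⟨haT.trans ht.1, ht.2⟩) haT.le hbT.le

theorem comp_mem_dwellSemigroup {X : U → ∀ q : M, TangentSpace (𝓡 d) q} {τ : ℝ} {g h : M → M}
    (hg : g ∈ dwellSemigroup X τ) (hh : h ∈ dwellSemigroup X τ) :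
    h ∘ g ∈ dwellSemigroup X τ := by
  obtain ⟨T₁, u₁, hu₁, hg⟩ := hg
  obtain ⟨T₂, u₂, hu₂, hh⟩ := hh
  refine ⟨T₁ + T₂, concat T₁ u₁ u₂, hu₁.concat hu₂, fun q => ?_⟩
  obtain ⟨γ₁, hγ₁, h10, h1T⟩ := hg q
  obtain ⟨γ₂, hγ₂, h20, h2T⟩ := hh (g q)
  have hjoin : γ₁ T₁ = γ₂ 0 := h1T.trans h20.symm
  refine ⟨concat T₁ γ₁ γ₂, hγ₁.concat hγ₂ hjoin, by rw [concat_of_le _ _ hu₁.nonneg, h10], ?_⟩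
  rw [concat_of_ge hjoin (le_add_of_nonneg_right hu₂.nonneg), add_sub_cancel_left, h2T]
  rfl

theorem flow_mem_dwellSemigroup {X : U → ∀ q : M, TangentSpace (𝓡 d) q} {τ t : ℝ} (hτ : 0 ≤ τ)
    (ht : τ ≤ t) (v : U) {Φ : ℝ → M → M} (h0 : ∀ q, Φ 0 q = q)
    (hΦ : ∀ q, IsMIntegralCurve (fun t => Φ t q) (X v)) : Φ t ∈ dwellSemigroup X τ := by
  refine ⟨t, fun _ => v, ⟨1, fun i => i * t, fun _ => v, one_pos, by simp, by simp, ?_⟩, fun q =>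
    ⟨fun s => Φ s q, fun a b w hab _ hw => ?_, h0 q, rfl⟩⟩
  · intro i hi
    obtain rfl : i = 0 := by omega
    simpa using ⟨hτ.trans ht, ht⟩
  · rw [← hw b (right_mem_Ioc.2 hab)]
    exact (hΦ q).isMIntegralCurveOn _

theorem dwellOrbit_subset_of_mem {X : U → ∀ q : M, TangentSpace (𝓡 d) q} {τ : ℝ} {p q : M}
    (h : p ∈ dwellOrbit X τ q) : dwellOrbit X τ p ⊆ dwellOrbit X τ q := by
  obtain ⟨g, hg, rfl⟩ := h
  rintro _ ⟨h, hh, rfl⟩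
  exact ⟨h ∘ g, comp_mem_dwellSemigroup hg hh, rfl⟩

/-- An invariant control set is determined by its closure: the union of two invariant control sets
with the same closure also satisfies the two defining properties. -/
theorem IsInvariantControlSet.eq_of_closure_eq {X : U → ∀ q : M, TangentSpace (𝓡 d) q} {τ : ℝ}
    {D D' : Set M} (hD : IsInvariantControlSet X τ D) (hD' : IsInvariantControlSet X τ D')
    (h : closure D = closure D') : D = D' := by
  have hi : StaysAtSplitTimes X τ (D ∪ D') := by
    rintro q (hq | hq)
    · obtain ⟨u, γ, hu, hγ, h0, hs⟩ := hD.1.1 q hq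
      exact ⟨u, γ, hu, hγ, h0, fun t ht h1 h2 => Or.inl (hs t ht h1 h2)⟩
    · obtain ⟨u, γ, hu, hγ, h0, hs⟩ := hD'.1.1 q hq
      exact ⟨u, γ, hu, hγ, h0, fun t ht h1 h2 => Or.inr (hs t ht h1 h2)⟩
  have hii : ApproxControllable X τ (D ∪ D') := by
    have hsub : D ∪ D' ⊆ closure D := union_subset subset_closure (h ▸ subset_closure)
    rintro q (hq | hq)
    · exact hsub.trans (hD.2 q hq).subset
    · exact hsub.trans (h.trans (hD'.2 q hq)).subset
  exact (hD.1.2.2 _ subset_union_left hi hii).symm.trans (hD'.1.2.2 _ subset_union_right hi hii)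

/-- Two invariant control sets coincide as soon as points `q ∈ D` and `q' ∈ D'` have orbits with a
nonempty open set in common: that open set contains points of `D` and points of `D'`. -/
theorem IsInvariantControlSet.eq_of_subset_orbits {X : U → ∀ q : M, TangentSpace (𝓡 d) q} {τ : ℝ}
    {D D' : Set M} (hD : IsInvariantControlSet X τ D) (hD' : IsInvariantControlSet X τ D')
    {q q' : M} (hq : q ∈ D) (hq' : q' ∈ D') {O : Set M} (hO : IsOpen O) (hne : O.Nonempty)
    (hOq : O ⊆ dwellOrbit X τ q) (hOq' : O ⊆ dwellOrbit X τ q') : D = D' := by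
  have key : ∀ {D D' : Set M}, IsInvariantControlSet X τ D → IsInvariantControlSet X τ D' →
      ∀ {q q' : M}, q ∈ D → q' ∈ D' → O ⊆ dwellOrbit X τ q → O ⊆ dwellOrbit X τ q' →
      closure D ⊆ closure D' := by
    intro D D' hD hD' q q' hq hq' hOq hOq'
    obtain ⟨x, hx⟩ := hne
    have hxD : x ∈ closure D := hD.2 q hq ▸ subset_closure (hOq hx)
    obtain ⟨z, hzO, hzD⟩ := mem_closure_iff.1 hxD O hO hx
    rw [hD.2 z hzD, hD'.2 q' hq']
    exact closure_mono (dwellOrbit_subset_of_mem (hOq' hzO))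
  exact hD.eq_of_closure_eq hD' ((key hD hD' hq hq' hOq hOq').antisymm (key hD' hD hq' hq hOq' hOq))

/-- Finiteness of the number of invariant control sets, by compactness, from the local existence of
open sets that are reachable from all points near a given one. -/
theorem finite_isInvariantControlSet [CompactSpace M] {X : U → ∀ q : M, TangentSpace (𝓡 d) q}
    {τ : ℝ} (h : ∀ q : M, ∃ N ∈ 𝓝 q, ∃ O : Set M, IsOpen O ∧ O.Nonempty ∧
      ∀ q' ∈ N, O ⊆ dwellOrbit X τ q') :
    {D : Set M | IsInvariantControlSet X τ D}.Finite := by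
  choose N hN O hO hne hNO using h
  obtain ⟨t, ht⟩ := CompactSpace.elim_nhds_subcover N hN
  -- sets meeting the same member of the cover coincide
  have hfin : ∀ x ∈ t, {D : Set M | IsInvariantControlSet X τ D ∧ (D ∩ N x).Nonempty}.Finite := by
    intro x _
    refine Set.Subsingleton.finite ?_
    rintro D ⟨hD, q, hqD, hqN⟩ D' ⟨hD', q', hqD', hqN'⟩
    exact hD.eq_of_subset_orbits hD' hqD hqD' (hO x) (hne x) (hNO x q hqN) (hNO x q' hqN')
  refine ((t.finite_toSet.biUnion hfin).union (finite_singleton ∅)).subset ?_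
  intro D hD
  rcases D.eq_empty_or_nonempty with rfl | ⟨q, hq⟩
  · exact Or.inr rfl
  · have hqt : q ∈ ⋃ x ∈ t, N x := ht ▸ mem_univ q
    obtain ⟨x, hx, hqx⟩ := mem_iUnion₂.1 hqt
    exact Or.inl (mem_biUnion hx ⟨hD, q, hq, hqx⟩)

end Semigroup

/-! ### Lie brackets of vector fields tangent to an immersion -/

section Tangent

variable {E E' : Type*} [NormedAddCommGroup E] [NormedSpace ℝ E]

section VectorSpace

variable [FiniteDimensional ℝ E] [NormedAddCommGroup E'] [NormedSpace ℝ E'] [FiniteDimensional ℝ E']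

/-- A vector field `Y` tangent to an immersion `ι` is `ι`-related to a differentiable field `y`;
this lemma differentiates the relation `Y ∘ ι = Dι · y`. The field `y` is differentiable because a
left inverse `L` of `Dι` at the base point expresses it as `(L ∘ Dι)⁻¹ (L (Y ∘ ι))`. -/
theorem exists_fderiv_eq_of_tangent {ι : E → E'} {x : E} (hι : ContDiffAt ℝ 2 ι x)
    (hinj : Function.Injective (fderiv ℝ ι x)) {Y : E' → E'} (hY : DifferentiableAt ℝ Y (ι x))
    (htan : ∀ᶠ x' in 𝓝 x, Y (ι x') ∈ range (fderiv ℝ ι x')) :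
    ∃ (y : E) (y' : E →L[ℝ] E), Y (ι x) = fderiv ℝ ι x y ∧
      ∀ w, fderiv ℝ Y (ι x) (fderiv ℝ ι x w) =
        fderiv ℝ (fderiv ℝ ι) x w y + fderiv ℝ ι x (y' w) := by
  have : CompleteSpace E := FiniteDimensional.complete ℝ E
  obtain ⟨L₀, hL₀⟩ := (fderiv ℝ ι x : E →ₗ[ℝ] E').exists_leftInverse_of_injective
    (LinearMap.ker_eq_bot.2 hinj)
  let L : E' →L[ℝ] E := L₀.toContinuousLinearMap
  have hL : L ∘L fderiv ℝ ι x = ContinuousLinearMap.id ℝ E := by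
    ext w
    exact LinearMap.congr_fun hL₀ w
  have hιd : DifferentiableAt ℝ ι x := hι.differentiableAt (by simp)
  have hdι : DifferentiableAt ℝ (fderiv ℝ ι) x :=
    (hι.fderiv_right (m := 1) (by norm_num)).differentiableAt (by simp)
  have hB : DifferentiableAt ℝ (fun x' => L ∘L fderiv ℝ ι x') x :=
    ((ContinuousLinearMap.compL ℝ E E' E L).differentiableAt).comp x hdι
  have hBinv : DifferentiableAt ℝ (fun x' => (L ∘L fderiv ℝ ι x').inverse) x := by
    have h1 := (contDiffAt_map_inverse (𝕜 := ℝ) (n := 1)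
      (ContinuousLinearEquiv.refl ℝ E)).differentiableAt (by simp)
    refine DifferentiableAt.comp x (f := fun x' => L ∘L fderiv ℝ ι x')
      (g := ContinuousLinearMap.inverse) ?_ hB
    rw [hL]
    exact h1
  have hinvert : ∀ᶠ x' in 𝓝 x, (L ∘L fderiv ℝ ι x').IsInvertible := by
    refine hB.continuousAt.eventually_mem (s := {A | A.IsInvertible}) ?_
    rw [hL]
    exact (ContinuousLinearEquiv.refl ℝ E).nhds
  let y : E → E := fun x' => (L ∘L fderiv ℝ ι x').inverse (L (Y (ι x')))
  have hy : DifferentiableAt ℝ y x :=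
    hBinv.clm_apply ((L.differentiableAt).comp x (hY.comp x hιd))
  have hrel : (fun x' => Y (ι x')) =ᶠ[𝓝 x] fun x' => fderiv ℝ ι x' (y x') := by
    filter_upwards [htan, hinvert] with x' ⟨w, hw⟩ hx'
    have : y x' = w := by
      obtain ⟨e, he⟩ := hx'
      simp only [y]
      rw [← hw, ← ContinuousLinearMap.comp_apply L, ← he, ContinuousLinearMap.inverse_equiv]
      simp
    rw [this, hw]
  refine ⟨y x, fderiv ℝ y x, hrel.self_of_nhds, fun w => ?_⟩
  have h1 : HasFDerivAt (fun x' => Y (ι x')) (fderiv ℝ Y (ι x) ∘L fderiv ℝ ι x) x :=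
    hY.hasFDerivAt.comp x hιd.hasFDerivAt
  have h2 := (hdι.hasFDerivAt.clm_apply hy.hasFDerivAt).congr_of_eventuallyEq hrel
  have h3 := DFunLike.congr_fun (h1.unique h2) w
  simpa [add_comm] using h3

theorem lieBracket_mem_range {ι : E → E'} {x : E} (hι : ContDiffAt ℝ 2 ι x)
    (hinj : Function.Injective (fderiv ℝ ι x)) {Y Z : E' → E'}
    (hY : DifferentiableAt ℝ Y (ι x)) (hZ : DifferentiableAt ℝ Z (ι x))
    (hYt : ∀ᶠ x' in 𝓝 x, Y (ι x') ∈ range (fderiv ℝ ι x'))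
    (hZt : ∀ᶠ x' in 𝓝 x, Z (ι x') ∈ range (fderiv ℝ ι x')) :
    VectorField.lieBracket ℝ Y Z (ι x) ∈ range (fderiv ℝ ι x) := by
  obtain ⟨y, y', hy, hy'⟩ := exists_fderiv_eq_of_tangent hι hinj hY hYt
  obtain ⟨z, z', hz, hz'⟩ := exists_fderiv_eq_of_tangent hι hinj hZ hZt
  refine ⟨z' y - y' z, ?_⟩
  have hsymm := hι.isSymmSndFDerivAt (by simp) y z
  change _ = fderiv ℝ Z (ι x) (Y (ι x)) - fderiv ℝ Y (ι x) (Z (ι x))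
  rw [hy, hz, hy', hz', map_sub, hsymm]
  abel

end VectorSpace

variable {d : ℕ} {M : Type*} [TopologicalSpace M] [ChartedSpace (EuclideanSpace ℝ (Fin d)) M]
  [IsManifold (𝓡 d) ∞ M]

/-- The coordinate expression of a vector field in a chart. -/
theorem mpullbackWithin_extChartAt_symm_apply (V : ∀ q : M, TangentSpace (𝓡 d) q) {q₀ p : M}
    (hp : p ∈ (extChartAt (𝓡 d) q₀).source) :
    VectorField.mpullbackWithin 𝓘(ℝ, EuclideanSpace ℝ (Fin d)) (𝓡 d) (extChartAt (𝓡 d) q₀).symm V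
      (range (𝓡 d)) (extChartAt (𝓡 d) q₀ p) =
    mfderiv (𝓡 d) 𝓘(ℝ, EuclideanSpace ℝ (Fin d)) (extChartAt (𝓡 d) q₀) p (V p) := by
  have : IsManifold (𝓡 d) 1 M := IsManifold.of_le (n := ∞) (by simp)
  have hy := (extChartAt (𝓡 d) q₀).map_source hp
  have hinv := ContinuousLinearMap.inverse_eq
    (mfderivWithin_extChartAt_symm_comp_mfderiv_extChartAt (I := 𝓡 d) hy)
    (mfderiv_extChartAt_comp_mfderivWithin_extChartAt_symm (I := 𝓡 d) hy)
  rw [VectorField.mpullbackWithin_apply, hinv, (extChartAt (𝓡 d) q₀).left_inv hp]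

theorem eventually_fderiv_extChartAt_comp {F : E → M} {x : E}
    (hF : ContMDiffAt 𝓘(ℝ, E) (𝓡 d) 2 F x) :
    ∀ᶠ x' in 𝓝 x, F x' ∈ (extChartAt (𝓡 d) (F x)).source ∧
      ∀ w, fderiv ℝ (fun x' => extChartAt (𝓡 d) (F x) (F x')) x' w =
        mfderiv (𝓡 d) 𝓘(ℝ, EuclideanSpace ℝ (Fin d)) (extChartAt (𝓡 d) (F x)) (F x')
          (mfderiv 𝓘(ℝ, E) (𝓡 d) F x' w) := by
  have : IsManifold (𝓡 d) 1 M := IsManifold.of_le (n := ∞) (by simp)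
  have : IsManifold (𝓡 d) 2 M := IsManifold.of_le (n := ∞) ENat.LEInfty.out
  filter_upwards [hF.continuousAt.eventually_mem (extChartAt_source_mem_nhds (I := 𝓡 d) (F x)),
    (contMDiffAt_iff_contMDiffAt_nhds (by simp)).1 hF] with x' hx' hd
  refine ⟨hx', fun w => ?_⟩
  have h1 : MDifferentiableAt (𝓡 d) 𝓘(ℝ, EuclideanSpace ℝ (Fin d)) (extChartAt (𝓡 d) (F x))
      (F x') := mdifferentiableAt_extChartAt (by rwa [← extChartAt_source (𝓡 d)])
  have h2 := mfderiv_comp x' h1 (hd.mdifferentiableAt (by simp))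
  rw [mfderiv_eq_fderiv] at h2
  exact DFunLike.congr_fun h2 w

theorem contDiffAt_extChartAt_comp {F : E → M} {x : E}
    (hF : ContMDiffAt 𝓘(ℝ, E) (𝓡 d) 2 F x) :
    ContDiffAt ℝ 2 (fun x' => extChartAt (𝓡 d) (F x) (F x')) x := by
  have : IsManifold (𝓡 d) 2 M := IsManifold.of_le (n := ∞) ENat.LEInfty.out
  rw [← contMDiffAt_iff_contDiffAt]
  exact (contMDiffAt_extChartAt (n := 2)).comp x hF

variable [FiniteDimensional ℝ E]

theorem eventually_injective_mfderiv {F : E → M} {x : E}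
    (hF : ContMDiffAt 𝓘(ℝ, E) (𝓡 d) 2 F x)
    (hinj : Function.Injective (mfderiv 𝓘(ℝ, E) (𝓡 d) F x)) :
    ∀ᶠ x' in 𝓝 x, Function.Injective (mfderiv 𝓘(ℝ, E) (𝓡 d) F x') := by
  have : IsManifold (𝓡 d) 1 M := IsManifold.of_le (n := ∞) (by simp)
  have hchain := eventually_fderiv_extChartAt_comp hF
  have hc : ContinuousAt (fderiv ℝ (fun x' => extChartAt (𝓡 d) (F x) (F x'))) x :=
    ((contDiffAt_extChartAt_comp hF).fderiv_right (m := 1) (by norm_num)).continuousAt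
  have hx : Function.Injective (fderiv ℝ (fun x' => extChartAt (𝓡 d) (F x) (F x')) x) := by
    intro a b hab
    rw [hchain.self_of_nhds.2, hchain.self_of_nhds.2] at hab
    exact hinj ((isInvertible_mfderiv_extChartAt (mem_extChartAt_source (F x))).injective hab)
  filter_upwards [hchain, hc.eventually_mem (ContinuousLinearMap.isOpen_injective.mem_nhds hx)]
    with x' hx' hi a b hab
  refine hi ?_
  exact (hx'.2 a).trans ((congrArg _ hab).trans (hx'.2 b).symm)

/-- On a manifold too, the Lie bracket of two vector fields tangent to an immersion is tangent to it:
this is `lieBracket_mem_range` for the coordinate expressions in a chart. -/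
theorem mlieBracket_mem_range {F : E → M} {x : E} (hF : ContMDiffAt 𝓘(ℝ, E) (𝓡 d) 2 F x)
    (hinj : Function.Injective (mfderiv 𝓘(ℝ, E) (𝓡 d) F x))
    {V W : ∀ q : M, TangentSpace (𝓡 d) q}
    (hV : MDifferentiableAt (𝓡 d) (𝓡 d).tangent
      (fun q => (⟨q, V q⟩ : TangentBundle (𝓡 d) M)) (F x))
    (hW : MDifferentiableAt (𝓡 d) (𝓡 d).tangent
      (fun q => (⟨q, W q⟩ : TangentBundle (𝓡 d) M)) (F x))
    (hVt : ∀ᶠ x' in 𝓝 x, V (F x') ∈ range (mfderiv 𝓘(ℝ, E) (𝓡 d) F x'))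
    (hWt : ∀ᶠ x' in 𝓝 x, W (F x') ∈ range (mfderiv 𝓘(ℝ, E) (𝓡 d) F x')) :
    VectorField.mlieBracket (𝓡 d) V W (F x) ∈ range (mfderiv 𝓘(ℝ, E) (𝓡 d) F x) := by
  have : IsManifold (𝓡 d) 1 M := IsManifold.of_le (n := ∞) (by simp)
  have : IsManifold (𝓡 d) 2 M := IsManifold.of_le (n := ∞) ENat.LEInfty.out
  let ψ := extChartAt (𝓡 d) (F x)
  let ι : E → EuclideanSpace ℝ (Fin d) := fun x' => ψ (F x')
  have hchain' := eventually_fderiv_extChartAt_comp hF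
  have hsrc : ∀ᶠ x' in 𝓝 x, F x' ∈ ψ.source := hchain'.mono fun _ h => h.1
  have hchain : ∀ᶠ x' in 𝓝 x, ∀ w, fderiv ℝ ι x' w =
      mfderiv (𝓡 d) 𝓘(ℝ, EuclideanSpace ℝ (Fin d)) ψ (F x') (mfderiv 𝓘(ℝ, E) (𝓡 d) F x' w) :=
    hchain'.mono fun _ h => h.2
  have hι : ContDiffAt ℝ 2 ι x := contDiffAt_extChartAt_comp hF
  have htan : ∀ {V : ∀ q : M, TangentSpace (𝓡 d) q},
      (∀ᶠ x' in 𝓝 x, V (F x') ∈ range (mfderiv 𝓘(ℝ, E) (𝓡 d) F x')) →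
      ∀ᶠ x' in 𝓝 x, VectorField.mpullbackWithin 𝓘(ℝ, EuclideanSpace ℝ (Fin d)) (𝓡 d) ψ.symm V
        (range (𝓡 d)) (ι x') ∈ range (fderiv ℝ ι x') := by
    intro V hVt
    filter_upwards [hVt, hsrc, hchain] with x' ⟨w, hw⟩ hx' hc
    exact ⟨w, (hc w).trans ((congrArg _ hw).trans
      (mpullbackWithin_extChartAt_symm_apply V hx').symm)⟩
  have hdiff : ∀ {V : ∀ q : M, TangentSpace (𝓡 d) q}, MDifferentiableAt (𝓡 d) (𝓡 d).tangent
      (fun q => (⟨q, V q⟩ : TangentBundle (𝓡 d) M)) (F x) →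
      DifferentiableAt ℝ (VectorField.mpullbackWithin 𝓘(ℝ, EuclideanSpace ℝ (Fin d)) (𝓡 d) ψ.symm V
        (range (𝓡 d))) (ι x) := by
    intro V hV
    exact (hV.mdifferentiableWithinAt (s := univ)
      |>.differentiableWithinAt_mpullbackWithin_vectorField).differentiableAt (by simp)
  have hιinj : Function.Injective (fderiv ℝ ι x) := by
    intro a b hab
    rw [hchain.self_of_nhds, hchain.self_of_nhds] at hab
    exact hinj ((isInvertible_mfderiv_extChartAt (mem_extChartAt_source (F x))).injective hab)
  obtain ⟨a, ha⟩ := lieBracket_mem_range hι hιinj (hdiff hV) (hdiff hW) (htan hVt) (htan hWt)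
  have hbracket : ∀ Y Z : EuclideanSpace ℝ (Fin d) → EuclideanSpace ℝ (Fin d),
      VectorField.lieBracketWithin ℝ Y Z (ψ.symm ⁻¹' univ ∩ range (𝓡 d)) (ι x) =
        VectorField.lieBracket ℝ Y Z (ι x) := by
    intro Y Z
    rw [show (ψ.symm ⁻¹' univ ∩ range (𝓡 d) : Set (EuclideanSpace ℝ (Fin d))) = univ by simp,
      VectorField.lieBracketWithin_univ]
  exact ⟨a, ((isInvertible_mfderiv_extChartAt (mem_extChartAt_source (F x))).inverse_apply_eq.2
    ((hbracket _ _).trans (ha.symm.trans (hchain.self_of_nhds a)))).symm⟩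

/-- The smooth vector fields tangent to an immersion form a Lie algebra, which contains the generated
Lie algebra if it contains the generators. -/
theorem lieHull_tangent {U : Type*} {X : U → ∀ q : M, TangentSpace (𝓡 d) q}
    (hX : ∀ v : U, ContMDiff (𝓡 d) (𝓡 d).tangent ∞
      (fun q => (⟨q, X v q⟩ : TangentBundle (𝓡 d) M)))
    {F : E → M} {S : Set E} (hS : IsOpen S) (hF : ∀ x ∈ S, ContMDiffAt 𝓘(ℝ, E) (𝓡 d) 2 F x)
    (hinj : ∀ x ∈ S, Function.Injective (mfderiv 𝓘(ℝ, E) (𝓡 d) F x))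
    (htan : ∀ x ∈ S, ∀ v, X v (F x) ∈ range (mfderiv 𝓘(ℝ, E) (𝓡 d) F x))
    {Y : ∀ q : M, TangentSpace (𝓡 d) q} (hY : Y ∈ lieHull (range X)) {x : E} (hx : x ∈ S) :
    Y (F x) ∈ range (mfderiv 𝓘(ℝ, E) (𝓡 d) F x) := by
  let L : Submodule ℝ (∀ q : M, TangentSpace (𝓡 d) q) :=
    { carrier := {Y | ContMDiff (𝓡 d) (𝓡 d).tangent ∞
          (fun q => (⟨q, Y q⟩ : TangentBundle (𝓡 d) M)) ∧
        ∀ x ∈ S, Y (F x) ∈ range (mfderiv 𝓘(ℝ, E) (𝓡 d) F x)}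
      add_mem' := fun {Y Z} hY hZ => ⟨hY.1.add_section hZ.1, fun x hx => by
        obtain ⟨a, ha⟩ := hY.2 x hx
        obtain ⟨b, hb⟩ := hZ.2 x hx
        exact ⟨a + b, by rw [map_add, ha, hb]; rfl⟩⟩
      zero_mem' := ⟨Bundle.contMDiff_zeroSection ℝ _, fun x _ => ⟨0, map_zero _⟩⟩
      smul_mem' := fun c Y hY => ⟨hY.1.const_smul_section, fun x hx => by
        obtain ⟨a, ha⟩ := hY.2 x hx
        exact ⟨c • a, by rw [map_smul, ha]; rfl⟩⟩ }
  have hL : lieHull (range X) ≤ L := by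
    refine sInf_le ⟨?_, ?_⟩
    · rintro _ ⟨v, rfl⟩
      exact ⟨hX v, fun x hx => htan x hx v⟩
    · intro V hV W hW
      have : IsManifold (𝓡 d) ((⊤ : ℕ∞) + 1) M := by simpa
      have : IsManifold (𝓡 d) (minSmoothness ℝ 2) M :=
        IsManifold.of_le (n := ∞) (by simpa using ENat.LEInfty.out)
      refine ⟨ContDiff.mlieBracket_vectorField (m := ⊤) (n := ⊤) hV.1 hW.1 (by simp),
        fun x hx => ?_⟩
      have hnear : ∀ᶠ x' in 𝓝 x, x' ∈ S := hS.mem_nhds hx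
      exact mlieBracket_mem_range (hF x hx) (hinj x hx)
        (hV.1.mdifferentiable (by simp) _) (hW.1.mdifferentiable (by simp) _)
        (hnear.mono fun x' h => hV.2 x' h) (hnear.mono fun x' h => hW.2 x' h)
  exact (hL hY).2 x hx

end Tangent

/-! ### Accessibility -/

section Accessibility

variable {d : ℕ} {M U : Type*} [TopologicalSpace M] [ChartedSpace (EuclideanSpace ℝ (Fin d)) M]

/-- A smooth family `F (x, ·)`, `x ∈ E`, of self-maps of `M` whose members with parameters in the
open set `W` belong to the dwell-time semigroup. -/
structure IsReachFamily (X : U → ∀ q : M, TangentSpace (𝓡 d) q) (τ : ℝ) {E : Type*}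
    [NormedAddCommGroup E] [NormedSpace ℝ E] (F : E × M → M) (W : Set E) : Prop where
  isOpen : IsOpen W
  contMDiff : ContMDiff (𝓘(ℝ, E).prod (𝓡 d)) (𝓡 d) ∞ F
  mem : ∀ x ∈ W, (fun q => F (x, q)) ∈ dwellSemigroup X τ

theorem IsReachFamily.contMDiff_left {X : U → ∀ q : M, TangentSpace (𝓡 d) q} {τ : ℝ} {E : Type*}
    [NormedAddCommGroup E] [NormedSpace ℝ E] {F : E × M → M} {W : Set E}
    (h : IsReachFamily X τ F W) (q : M) : ContMDiff 𝓘(ℝ, E) (𝓡 d) ∞ (fun x => F (x, q)) :=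
  h.contMDiff.comp (contMDiff_id.prodMk contMDiff_const)

/-- There is a family of reachable points of `q`, smoothly parametrized by `r` parameters, that is
an immersion at some parameter. -/
def HasReachableImmersion (X : U → ∀ q : M, TangentSpace (𝓡 d) q) (τ : ℝ) (q : M) (r : ℕ) : Prop :=
  ∃ (E : Type) (_ : NormedAddCommGroup E) (_ : NormedSpace ℝ E) (_ : FiniteDimensional ℝ E)
    (F : E × M → M) (W : Set E) (x : E), Module.finrank ℝ E = r ∧ IsReachFamily X τ F W ∧ x ∈ W ∧
      Function.Injective (mfderiv 𝓘(ℝ, E) (𝓡 d) (fun x => F (x, q)) x)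

/-- There is a family of reachable points of `q` that is a submersion at some parameter. -/
def HasReachableSubmersion (X : U → ∀ q : M, TangentSpace (𝓡 d) q) (τ : ℝ) (q : M) : Prop :=
  ∃ (E : Type) (_ : NormedAddCommGroup E) (_ : NormedSpace ℝ E) (_ : FiniteDimensional ℝ E)
    (F : E × M → M) (W : Set E) (x : E), IsReachFamily X τ F W ∧ x ∈ W ∧
      Function.Surjective (mfderiv 𝓘(ℝ, E) (𝓡 d) (fun x => F (x, q)) x)

theorem HasReachableImmersion.le {X : U → ∀ q : M, TangentSpace (𝓡 d) q} {τ : ℝ} {q : M} {r : ℕ}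
    (h : HasReachableImmersion X τ q r) : r ≤ d := by
  obtain ⟨E, _, _, _, F, W, x, rfl, -, -, hinj⟩ := h
  have := LinearMap.finrank_le_finrank_of_injective (R := ℝ) (M := E)
    (M' := EuclideanSpace ℝ (Fin d))
    (f := (mfderiv 𝓘(ℝ, E) (𝓡 d) (fun x => F (x, q)) x).toLinearMap) hinj
  simpa using this

theorem eq_zero_of_add_smul_eq_zero {E F : Type*} [AddCommGroup E] [Module ℝ E]
    [TopologicalSpace E] [AddCommGroup F] [Module ℝ F] [TopologicalSpace F] {A : E →L[ℝ] F} {w : F}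
    (hw : w ∉ range A) {x : E} {c : ℝ} (h : A x + c • w = 0) : c = 0 := by
  by_contra hc
  refine hw ⟨-(c⁻¹ • x), ?_⟩
  rw [map_neg, map_smul, eq_neg_of_add_eq_zero_left h, smul_neg, neg_neg, smul_smul,
    inv_mul_cancel₀ hc, one_smul]

variable [IsManifold (𝓡 d) ∞ M]

/-- Flowing an immersion `f` along a vector field that is transversal to it at `f x` gives an
immersion with one more parameter, at any time `s`. The flow at time `-s` brings the derivative back
to the point `f x`, because a vector field is invariant under its own flow. -/
theorem injective_mfderiv_flow {E : Type*} [NormedAddCommGroup E] [NormedSpace ℝ E]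
    [FiniteDimensional ℝ E] {V : ∀ q : M, TangentSpace (𝓡 d) q} {Φ : ℝ → M → M}
    (h0 : ∀ q, Φ 0 q = q) (hΦ : ∀ q, IsMIntegralCurve (fun t => Φ t q) V)
    (hadd : ∀ s t q, Φ (s + t) q = Φ s (Φ t q))
    (hsmooth : ContMDiff (𝓘(ℝ, ℝ).prod (𝓡 d)) (𝓡 d) ∞ (fun p : ℝ × M => Φ p.1 p.2))
    {f : E → M} (hf : ContMDiff 𝓘(ℝ, E) (𝓡 d) ∞ f) {x : E}
    (hinj : Function.Injective (mfderiv 𝓘(ℝ, E) (𝓡 d) f x))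
    (hV : V (f x) ∉ range (mfderiv 𝓘(ℝ, E) (𝓡 d) f x)) (s : ℝ) :
    Function.Injective (mfderiv 𝓘(ℝ, E × ℝ) (𝓡 d) (fun z : E × ℝ => Φ z.2 (f z.1)) (x, s)) := by
  have : IsManifold (𝓡 d) 1 M := IsManifold.of_le (n := ∞) (by simp)
  let ψ := extChartAt (𝓡 d) (f x)
  let K : E × ℝ → M := fun z => Φ z.2 (f z.1)
  have hK : ContMDiff 𝓘(ℝ, E × ℝ) (𝓡 d) ∞ K :=
    hsmooth.comp ((contDiff_snd.contMDiff).prodMk (hf.comp contDiff_fst.contMDiff))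
  have hΦs : ContMDiff (𝓡 d) (𝓡 d) ∞ (Φ (-s)) :=
    hsmooth.comp (contMDiff_const.prodMk contMDiff_id)
  have hback : Φ (-s) (K (x, s)) = f x := by
    simp only [K]
    rw [← hadd, neg_add_cancel, h0]
  have hψ : MDifferentiableAt (𝓡 d) 𝓘(ℝ, EuclideanSpace ℝ (Fin d)) ψ (f x) :=
    mdifferentiableAt_extChartAt (mem_chart_source _ _)
  have hψΦ : MDifferentiableAt (𝓡 d) 𝓘(ℝ, EuclideanSpace ℝ (Fin d)) (fun p => ψ (Φ (-s) p))
      (K (x, s)) := by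
    refine MDifferentiableAt.comp (K (x, s)) (g := ψ) (f := Φ (-s)) ?_
      (hΦs.mdifferentiable (by simp) _)
    rwa [hback]
  let κ : E × ℝ → EuclideanSpace ℝ (Fin d) := fun z => ψ (Φ (-s) (K z))
  have hκ := mfderiv_comp (x, s) hψΦ (hK.mdifferentiable (by simp) (x, s))
  rw [mfderiv_eq_fderiv] at hκ
  have hκd : DifferentiableAt ℝ κ (x, s) := by
    rw [← mdifferentiableAt_iff_differentiableAt]
    exact hψΦ.comp (x, s) (hK.mdifferentiable (by simp) (x, s))
  have hleft : ∀ ξ : E, fderiv ℝ κ (x, s) (ξ, 0) =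
      mfderiv (𝓡 d) 𝓘(ℝ, EuclideanSpace ℝ (Fin d)) ψ (f x) (mfderiv 𝓘(ℝ, E) (𝓡 d) f x ξ) := by
    intro ξ
    have h1 : HasFDerivAt (fun x' => κ (x', s))
        (fderiv ℝ κ (x, s) ∘L ContinuousLinearMap.inl ℝ E ℝ) x :=
      HasFDerivAt.comp x (f := fun x' => (x', s)) (g := κ) hκd.hasFDerivAt
        (hasFDerivAt_prodMk_left x s)
    have h2 : (fun x' => κ (x', s)) = fun x' => ψ (f x') := by
      funext x'
      simp only [κ, K]
      rw [← hadd, neg_add_cancel, h0]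
    rw [h2] at h1
    have h3 := (eventually_fderiv_extChartAt_comp
      ((hf.of_le ENat.LEInfty.out).contMDiffAt (x := x))).self_of_nhds.2 ξ
    rw [← h3]
    exact (DFunLike.congr_fun h1.fderiv ξ).symm
  have hright : fderiv ℝ κ (x, s) (0, 1) =
      mfderiv (𝓡 d) 𝓘(ℝ, EuclideanSpace ℝ (Fin d)) ψ (f x) (V (f x)) := by
    have h1 : HasFDerivAt (fun s' => κ (x, s'))
        (fderiv ℝ κ (x, s) ∘L ContinuousLinearMap.inr ℝ E ℝ) s :=
      HasFDerivAt.comp s (f := fun s' => (x, s')) (g := κ) hκd.hasFDerivAt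
        (hasFDerivAt_prodMk_right x s)
    have h2 : (fun s' => κ (x, s')) = fun s' => ψ (Φ (s' + -s) (f x)) := by
      funext s'
      simp only [κ, K]
      rw [← hadd, add_comm]
    rw [h2] at h1
    have h3 : HasMFDerivAt 𝓘(ℝ, ℝ) (𝓡 d) (fun s' => Φ (s' + -s) (f x)) s
        ((1 : ℝ →L[ℝ] ℝ).smulRight (V (Φ (s + -s) (f x)))) := (hΦ (f x)).comp_add (-s) s
    have h4 : MDifferentiableAt (𝓡 d) 𝓘(ℝ, EuclideanSpace ℝ (Fin d)) ψ (Φ (s + -s) (f x)) := by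
      rwa [add_neg_cancel, h0]
    have h5 := (HasMFDerivAt.comp s (f := fun s' => Φ (s' + -s) (f x)) h4.hasMFDerivAt
      h3).hasFDerivAt
    have h6 := DFunLike.congr_fun (h1.unique h5) 1
    have h7 : ∀ p, p = f x →
        (mfderiv (𝓡 d) 𝓘(ℝ, EuclideanSpace ℝ (Fin d)) ψ p (V p) : EuclideanSpace ℝ (Fin d)) =
          mfderiv (𝓡 d) 𝓘(ℝ, EuclideanSpace ℝ (Fin d)) ψ (f x) (V (f x)) := by
      rintro p rfl
      rfl
    rw [← h7 (Φ (s + -s) (f x)) (by rw [add_neg_cancel, h0])]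
    refine h6.trans ?_
    exact congrArg _ (one_smul ℝ (V (Φ (s + -s) (f x))))
  have hκinj : ∀ z : E × ℝ, fderiv ℝ κ (x, s) z = 0 → z = 0 := by
    rintro ⟨ξ, σ⟩ hz
    have h1 : ((ξ, σ) : E × ℝ) = (ξ, 0) + σ • ((0, 1) : E × ℝ) := by simp
    rw [h1, map_add, map_smul, hleft, hright] at hz
    have h2 : mfderiv 𝓘(ℝ, E) (𝓡 d) f x ξ + σ • V (f x) = 0 := by
      refine (isInvertible_mfderiv_extChartAt (I := 𝓡 d) (mem_extChartAt_source (f x))).injective ?_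
      rw [map_add, map_smul, map_zero]
      exact hz
    have hσ : σ = 0 := eq_zero_of_add_smul_eq_zero hV h2
    subst hσ
    rw [zero_smul, add_zero] at h2
    rw [hinj (h2.trans (map_zero _).symm)]
    rfl
  refine (injective_iff_map_eq_zero _).2 fun z hz => hκinj z ?_
  refine (DFunLike.congr_fun hκ z).trans ?_
  exact (congrArg _ hz).trans (ContinuousLinearMap.map_zero _)

/-- A submersive family of reachable points reaches a fixed open set from all points near `q`. -/
theorem HasReachableSubmersion.exists_isOpen_subset_dwellOrbit
    {X : U → ∀ q : M, TangentSpace (𝓡 d) q} {τ : ℝ} {q : M} (h : HasReachableSubmersion X τ q) :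
    ∃ N ∈ 𝓝 q, ∃ O : Set M, IsOpen O ∧ O.Nonempty ∧ ∀ q' ∈ N, O ⊆ dwellOrbit X τ q' := by
  obtain ⟨E, _, _, _, F, W, x, hF, hx, hsurj⟩ := h
  have : IsManifold (𝓡 d) 1 M := IsManifold.of_le (n := ∞) (by simp)
  have : CompleteSpace E := FiniteDimensional.complete ℝ E
  let χ := extChartAt (𝓡 d) q
  let ψ := extChartAt (𝓡 d) (F (x, q))
  let j : E × EuclideanSpace ℝ (Fin d) → E × M := fun z => (z.1, χ.symm z.2)
  have hjx : j (x, χ q) = (x, q) := by simp [j, χ]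
  have hj : ContMDiffAt 𝓘(ℝ, E × EuclideanSpace ℝ (Fin d)) (𝓘(ℝ, E).prod (𝓡 d)) 1 j (x, χ q) := by
    refine (contDiff_fst.contMDiff.contMDiffAt).prodMk ?_
    have h1 : ContMDiffAt 𝓘(ℝ, EuclideanSpace ℝ (Fin d)) (𝓡 d) 1 χ.symm (χ q) :=
      (contMDiffOn_extChartAt_symm q).contMDiffAt (extChartAt_target_mem_nhds q)
    exact ContMDiffAt.comp (x, χ q) (g := χ.symm)
      (f := fun z : E × EuclideanSpace ℝ (Fin d) => z.2) h1 contDiff_snd.contMDiff.contMDiffAt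
  let h : E × EuclideanSpace ℝ (Fin d) → EuclideanSpace ℝ (Fin d) := fun z => ψ (F (j z))
  have hFj : ContMDiffAt 𝓘(ℝ, E × EuclideanSpace ℝ (Fin d)) (𝓡 d) 1 (fun z => F (j z))
      (x, χ q) :=
    ContMDiffAt.comp (x, χ q) (g := F) (f := j)
      ((hF.contMDiff.of_le (by simp)).contMDiffAt) hj
  have hd : ContDiffAt ℝ 1 h (x, χ q) := by
    rw [← contMDiffAt_iff_contDiffAt]
    refine ContMDiffAt.comp (x, χ q) (g := ψ) (f := fun z => F (j z)) ?_ hFj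
    rw [hjx]
    exact contMDiffAt_extChartAt
  have hstrict := hd.hasStrictFDerivAt (by simp)
  -- the partial derivative of `h` in the parameters is onto
  have hpart : ∀ ζ, ∃ ξ, fderiv ℝ h (x, χ q) (ξ, 0) = ζ := by
    intro ζ
    have h1 : HasFDerivAt (fun x' => h (x', χ q))
        (fderiv ℝ h (x, χ q) ∘L ContinuousLinearMap.inl ℝ E _) x :=
      HasFDerivAt.comp x (f := fun x' => (x', χ q)) (g := h) hstrict.hasFDerivAt
        (hasFDerivAt_prodMk_left x (χ q))
    have h2 : (fun x' => h (x', χ q)) = fun x' => ψ (F (x', q)) := by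
      funext x'
      simp [h, j, χ]
    rw [h2] at h1
    have h3 := (eventually_fderiv_extChartAt_comp
      (((hF.contMDiff_left q).of_le ENat.LEInfty.out).contMDiffAt (x := x))).self_of_nhds.2
    have h4 := isInvertible_mfderiv_extChartAt (I := 𝓡 d) (mem_extChartAt_source (F (x, q)))
    obtain ⟨w, hw⟩ := h4.surjective ζ
    obtain ⟨ξ, hξ⟩ := hsurj w
    refine ⟨ξ, ?_⟩
    refine (DFunLike.congr_fun h1.fderiv ξ).symm.trans ((h3 ξ).trans ?_)
    exact (congrArg _ hξ).trans hw
  let H : E × EuclideanSpace ℝ (Fin d) → EuclideanSpace ℝ (Fin d) × EuclideanSpace ℝ (Fin d) :=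
    fun z => (z.2, h z)
  have hH : HasStrictFDerivAt H ((ContinuousLinearMap.snd ℝ E _).prod (fderiv ℝ h (x, χ q)))
      (x, χ q) := hasStrictFDerivAt_snd.prodMk hstrict
  have hHsurj : ((ContinuousLinearMap.snd ℝ E (EuclideanSpace ℝ (Fin d))).prod
      (fderiv ℝ h (x, χ q))).range = ⊤ := by
    refine LinearMap.range_eq_top.2 ?_
    rintro ⟨η, ζ⟩
    obtain ⟨ξ, hξ⟩ := hpart (ζ - fderiv ℝ h (x, χ q) (0, η))
    refine ⟨(ξ, η), Prod.ext rfl ?_⟩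
    have hsplit : ((ξ, η) : E × EuclideanSpace ℝ (Fin d)) = (ξ, 0) + (0, η) := by simp
    change fderiv ℝ h (x, χ q) (ξ, η) = ζ
    rw [hsplit, map_add, hξ, sub_add_cancel]
  have hmap := hH.map_nhds_eq_of_surj hHsurj
  have hgood : {z : E × EuclideanSpace ℝ (Fin d) | z.1 ∈ W ∧ F (j z) ∈ ψ.source} ∈
      𝓝 (x, χ q) := by
    refine Filter.inter_mem (continuousAt_fst.preimage_mem_nhds (hF.isOpen.mem_nhds hx)) ?_
    refine hFj.continuousAt.preimage_mem_nhds ?_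
    rw [hjx]
    exact extChartAt_source_mem_nhds _
  have himage := Filter.image_mem_map (m := H) hgood
  rw [hmap, show H (x, χ q) = (χ q, ψ (F (x, q))) by simp [H, h, hjx], nhds_prod_eq,
    Filter.mem_prod_iff] at himage
  obtain ⟨N₁, hN₁, O₁, hO₁, hsub⟩ := himage
  obtain ⟨O₂, hO₂, hO₂open, hO₂mem⟩ := mem_nhds_iff.1 hO₁
  refine ⟨χ.source ∩ χ ⁻¹' N₁, Filter.inter_mem (extChartAt_source_mem_nhds q)
    ((continuousAt_extChartAt q).preimage_mem_nhds hN₁), ψ.source ∩ ψ ⁻¹' O₂,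
    isOpen_extChartAt_preimage' _ hO₂open, ⟨F (x, q), mem_extChartAt_source _, hO₂mem⟩, ?_⟩
  rintro q' ⟨hq'1, hq'2⟩ p ⟨hp1, hp2⟩
  obtain ⟨z, ⟨hzW, hzs⟩, hz⟩ := hsub (mk_mem_prod hq'2 (hO₂ hp2))
  have hz1 : z.2 = χ q' := congrArg Prod.fst hz
  have hz2 : ψ (F (j z)) = ψ p := congrArg Prod.snd hz
  refine ⟨_, hF.mem z.1 hzW, ?_⟩
  have hz3 : j z = (z.1, q') := by simp [j, hz1, χ.left_inv hq'1]
  rw [← hz3]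
  exact ψ.injOn hzs hp1 hz2

variable [T2Space M] [CompactSpace M]

theorem HasReachableImmersion.zero [Nonempty U] {X : U → ∀ q : M, TangentSpace (𝓡 d) q}
    (hX : ∀ v : U, ContMDiff (𝓡 d) (𝓡 d).tangent ∞
      (fun q => (⟨q, X v q⟩ : TangentBundle (𝓡 d) M)))
    {Φ : U → ℝ → M → M} (h0 : ∀ v q, Φ v 0 q = q)
    (hΦ : ∀ v q, IsMIntegralCurve (fun t => Φ v t q) (X v)) {τ : ℝ} (hτ : 0 ≤ τ) (q : M) :
    HasReachableImmersion X τ q 0 := by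
  obtain ⟨v⟩ := ‹Nonempty U›
  refine ⟨EuclideanSpace ℝ (Fin 0), inferInstance, inferInstance, inferInstance,
    fun p => Φ v τ p.2, univ, 0, by simp, ⟨isOpen_univ, ?_, fun x _ =>
      flow_mem_dwellSemigroup hτ le_rfl v (h0 v) (hΦ v)⟩, mem_univ _, fun a b _ => ?_⟩
  · exact (contMDiff_flow (hX v) (h0 v) (hΦ v)).comp (contMDiff_const.prodMk contMDiff_snd)
  · exact Subsingleton.elim (α := EuclideanSpace ℝ (Fin 0)) a b

/-- If an immersed family of reachable points cannot be enlarged, all the vector fields `X v` are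
tangent to it near the given parameter. Then so are all elements of the generated Lie algebra, and
by the rank condition the family is a submersion. -/
theorem HasReachableImmersion.submersion_or_succ {X : U → ∀ q : M, TangentSpace (𝓡 d) q}
    (hX : ∀ v : U, ContMDiff (𝓡 d) (𝓡 d).tangent ∞
      (fun q => (⟨q, X v q⟩ : TangentBundle (𝓡 d) M)))
    (hlie : LieRankCondition X)
    {Φ : U → ℝ → M → M} (h0 : ∀ v q, Φ v 0 q = q)
    (hΦ : ∀ v q, IsMIntegralCurve (fun t => Φ v t q) (X v)) {τ : ℝ} (hτ : 0 ≤ τ) {q : M} {r : ℕ}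
    (h : HasReachableImmersion X τ q r) :
    HasReachableSubmersion X τ q ∨ HasReachableImmersion X τ q (r + 1) := by
  obtain ⟨E, _, _, _, F, W, x, hr, hF, hx, hinj⟩ := h
  have hf := hF.contMDiff_left q
  have hf2 : ContMDiff 𝓘(ℝ, E) (𝓡 d) 2 (fun x => F (x, q)) := hf.of_le ENat.LEInfty.out
  obtain ⟨S, hS, hSopen, hxS⟩ := mem_nhds_iff.1 (Filter.inter_mem (hF.isOpen.mem_nhds hx)
    (eventually_injective_mfderiv hf2.contMDiffAt hinj))
  by_cases htan : ∀ x ∈ S, ∀ v, X v (F (x, q)) ∈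
      range (mfderiv 𝓘(ℝ, E) (𝓡 d) (fun x => F (x, q)) x)
  · refine Or.inl ⟨E, _, _, inferInstance, F, W, x, hF, hx, fun w => ?_⟩
    obtain ⟨Y, hY, rfl⟩ := hlie (F (x, q)) w
    exact lieHull_tangent hX hSopen (fun x _ => hf2.contMDiffAt) (fun x hx => (hS hx).2) htan hY hxS
  · push Not at htan
    obtain ⟨y, hy, v, hv⟩ := htan
    have hsm := contMDiff_flow (hX v) (h0 v) (hΦ v)
    refine Or.inr ⟨E × ℝ, inferInstance, inferInstance, inferInstance,
      fun p => Φ v p.1.2 (F (p.1.1, p.2)), W ×ˢ Ioi τ, (y, τ + 1), by simp [hr],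
      ⟨hF.isOpen.prod isOpen_Ioi, ?_, ?_⟩, ⟨(hS hy).1, by simp⟩, ?_⟩
    · have h1 : ContMDiff (𝓘(ℝ, E × ℝ).prod (𝓡 d)) 𝓘(ℝ, E × ℝ) ∞
          (fun p : (E × ℝ) × M => p.1) := contMDiff_fst
      exact hsm.comp ((contDiff_snd.contMDiff.comp h1).prodMk
        (hF.contMDiff.comp ((contDiff_fst.contMDiff.comp h1).prodMk contMDiff_snd)))
    · rintro ⟨x', s⟩ ⟨hx', hs⟩
      exact comp_mem_dwellSemigroup (hF.mem x' hx')
        (flow_mem_dwellSemigroup hτ (le_of_lt hs) v (h0 v) (hΦ v))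
    · exact injective_mfderiv_flow (h0 v) (hΦ v) (flow_add (hX v) (h0 v) (hΦ v)) hsm hf
        (hS hy).2 hv (τ + 1)

/-- An immersion of maximal dimension into the orbit of `q` is a submersion. -/
theorem hasReachableSubmersion [Nonempty U] {X : U → ∀ q : M, TangentSpace (𝓡 d) q}
    (hX : ∀ v : U, ContMDiff (𝓡 d) (𝓡 d).tangent ∞
      (fun q => (⟨q, X v q⟩ : TangentBundle (𝓡 d) M)))
    (hlie : LieRankCondition X)
    {Φ : U → ℝ → M → M} (h0 : ∀ v q, Φ v 0 q = q)
    (hΦ : ∀ v q, IsMIntegralCurve (fun t => Φ v t q) (X v)) {τ : ℝ} (hτ : 0 ≤ τ) (q : M) :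
    HasReachableSubmersion X τ q := by
  by_contra hno
  have hall : ∀ r, HasReachableImmersion X τ q r := by
    intro r
    induction r with
    | zero => exact HasReachableImmersion.zero hX h0 hΦ hτ q
    | succ r ih => exact (ih.submersion_or_succ hX hlie h0 hΦ hτ).resolve_left hno
  exact absurd (hall (d + 1)).le (by omega)

end Accessibility

end DwellTime

theorem proposition3p10 {d : ℕ} {M : Type*} [TopologicalSpace M]
    [ChartedSpace (EuclideanSpace ℝ (Fin d)) M] [IsManifold (𝓡 d) ∞ M]
    [T2Space M] [CompactSpace M]
    {U : Type*} [Nonempty U] (X : U → ∀ q : M, TangentSpace (𝓡 d) q)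
    (hsmooth : ∀ v : U, ContMDiff (𝓡 d) (𝓡 d).tangent ∞
      (fun q => (⟨q, X v q⟩ : TangentBundle (𝓡 d) M)))
    (hcomplete : ∀ (v : U) (q : M), ∃ γ : ℝ → M, γ 0 = q ∧ IsMIntegralCurve γ (X v))
    (hlie : DwellTime.LieRankCondition X)
    (τ : ℝ) (hτ : 0 ≤ τ) :
    {D : Set M | DwellTime.IsInvariantControlSet X τ D}.Finite := by
  choose Φ h0 hΦ using hcomplete
  exact DwellTime.finite_isInvariantControlSet fun q =>
    (DwellTime.hasReachableSubmersion (Φ := fun v t q => Φ v q t) hsmooth hlie h0 hΦ hτ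
      q).exists_isOpen_subset_dwellOrbit
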